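/- **Setting.** Fix a norm $|\cdot|$ on $\mathbb{R}^n$ and let $\|\cdot\|$ be the induced matrix norm. Let $A,A_0\colon\mathbb{R}\to M_n(\mathbb{R})$ be continuous, let $(t_i)_{i\in\mathbb{Z}}$, $(\zeta_i)_{i\in\mathbb{Z}}$ be real sequences, let $\gamma\colon\mathbb{R}\to\mathbb{R}$, and let $f,h\colon\mathbb{R}\times\mathbb{R}^n\times\mathbb{R}^n\to\mathbb{R}^n$ be continuous. Consider $$\dot y(t)=A(t)y(t)+A_0(t)y(\gamma(t)),\tag{1}$$ $$\dot x(t)=A(t)x(t)+A_0(t)x(\gamma(t))+f(t,x(t),x(\gamma(t))),\tag{2}$$ $$\dot x(t)=A(t)x(t)+A_0(t)x(\gamma(t))+h(t,x(t),x(\gamma(t))).\tag{3}$$ A *solution* of such a system is a continuous $u\colon\mathbb{R}\to\mathbb{R}^n$ that is differentiable at every $t\notin\{t_i\}$, has one-sided derivatives at every $t_i$, and satisfies the equation on each $(t_i,t_{i+1})$, and at each $t_i$ with the right derivative. The *transition matrix* $Z(t,\tau)$ of (1) is the matrix with $z(t)=Z(t,\tau)z(\tau)$ for every solution $z$ of (1)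 (it exists and is unique under (A), (B), (C) below). For a matrix function $Q$ put $$\rho_k^+(Q)=\exp\int_{t_k}^{\zeta_k}\|Q(s)\|\,ds,\qquad \rho_k^-(Q)=\exp\int_{\zeta_k}^{t_{k+1}}\|Q(s)\|\,ds,\qquad \rho(A)=\sup_{k\in\mathbb{Z}}\rho_k^+(A)\rho_k^-(A).$$ **Hypotheses.** We say that $f$ satisfies (S) if there are constants $M,M_0,\mu,\ell_1,\ell_2,\theta,\alpha>0$ and $K\ge1$ such that: * (A) $\|A(t)\|\le M$, $\|A_0(t)\|\le M_0$, $|f(t,x,y)|\le\mu$ and $|f(t,x,y)-f(t,x',y')|\le\ell_1|x-x'|+\ell_2|y-y'|$ for all $t\in\mathbb{R}$ and $x,x',y,y'\in\mathbb{R}^n$; * (B) $t_i<t_{i+1}$, $t_i\le\zeta_i\le t_{i+1}$, $t_{i+1}-t_i\le\theta$ and $\gamma(t)=\zeta_i$ for $t\in[t_i,t_{i+1})$, for all $i\in\mathbb{Z}$, and $t_i\to\pm\infty$ as $i\to\pm\infty$; * (C) there are $\nu^+,\nu^-\in(0,1)$ with $\rho_k^{+}(A)\ln\rho_k^{+}(A_0)\le\nu^{+}$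 and $\rho_k^{-}(A)\ln\rho_k^{-}(A_0)\le\nu^{-}$ for all $k\in\mathbb{Z}$; * (D) there is a projection $P$ ($P^2=P$) such that $\|Z(t,0)PZ(0,s)\|\le Ke^{-\alpha|t-s|}$ for $t\ge s$ and $\|Z(t,0)(I-P)Z(0,s)\|\le Ke^{-\alpha|t-s|}$ for $s>t$; * $2(\ell_1+\ell_2)K\rho(A)e^{\alpha\theta}<\alpha$; * $v:=\dfrac{e^{(M+\ell_1)\theta}-1}{(M+\ell_1)\theta}(M_0+\ell_2)\theta<1$ and $\tilde v:=\dfrac{e^{M\theta}-1}{M\theta}M_0\theta<1$. We say that $f$ satisfies (HS) if, for some such constants, moreover $$\alpha<M+\min\Big\{\ell_1+\frac{M_0+\ell_2}{1-v}e^{(M+\ell_1)\theta},\ \frac{M_0}{1-\tilde v}e^{M\theta}\Big\}.$$ **Equivalence.** Systems (2) and (3) are *strongly topologically equivalent* if there are $H,L\colon\mathbb{R}\times\mathbb{R}^n\to\mathbb{R}^n$ such that for each $t$ the maps $H(t,\cdot)$ and $L(t,\cdot)$ are mutually inverse homeomorphisms of $\mathbb{R}^n$; $H(t,u)-u$ and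 $L(t,u)-u$ are bounded on $\mathbb{R}\times\mathbb{R}^n$; $t\mapsto H(t,x(t))$ is a solution of (3) for every solution $x$ of (2), and $t\mapsto L(t,x(t))$ is a solution of (2) for every solution $x$ of (3); and $H(t,\cdot)$, $L(t,\cdot)$ are uniformly continuous, uniformly in $t$. They are *Hölder strongly topologically equivalent* if $H,L$ can moreover be chosen so that, for some $C_1,D_1>1$ and $C_2,D_2\in(0,1)$, for all $t\in\mathbb{R}$, $$|H(t,\xi)-H(t,\xi')|\le C_1|\xi-\xi'|^{C_2}\ \text{ if }|\xi-\xi'|<1,\qquad |L(t,\nu)-L(t,\nu')|\le D_1|\nu-\nu'|^{D_2}\ \text{ if }|\nu-\nu'|<1.$$ **Corollary 3.1.** If $f$ and $h$ both satisfy (S), then (2) and (3) are strongly topologically equivalent. If $f$ and $h$ both satisfy (HS), then (2) and (3) are Hölder strongly topologically equivalent. -/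

import Mathlib

/-! Differential equations with piecewise constant argument of generalized type (DEPCAG)
`x'(s) = F (s, x(s), x(γ(s)))`, where `γ = ζ i` on `[t i, t (i+1))`.

The phase space `ℝⁿ` with a vector norm is a finite-dimensional real normed space `E`; an
`n × n` matrix is a linear map `E →L[ℝ] E`, with the operator norm induced by the vector norm. -/

namespace DEPCAG

variable {E : Type*} [NormedAddCommGroup E] [NormedSpace ℝ E]

/-- Condition (B) on the sequences `t`, `ζ` and the argument function `γ`, with the constant `θ`. -/
structure ConditionB (t ζ : ℤ → ℝ) (γ : ℝ → ℝ) (θ : ℝ) : Prop where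
  lt_succ : ∀ i, t i < t (i + 1)
  zeta_mem : ∀ i, ζ i ∈ Set.Icc (t i) (t (i + 1))
  tendsto_top : Filter.Tendsto t Filter.atTop Filter.atTop
  tendsto_bot : Filter.Tendsto t Filter.atBot Filter.atBot
  gamma_eq : ∀ i, ∀ s ∈ Set.Ico (t i) (t (i + 1)), γ s = ζ i
  theta_pos : 0 < θ
  gap_le : ∀ i, t (i + 1) - t i ≤ θ

/-- `u : ℝ → E` is a solution of `u'(s) = F s (u s) (u (γ s))`: it is continuous, differentiable
off the points `t i`, has one-sided derivatives at the points `t i`, and satisfies the equation on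
every `(t i, t (i+1))`, and at `t i` for the right derivative. -/
structure IsSolution (t : ℤ → ℝ) (γ : ℝ → ℝ) (F : ℝ → E → E → E) (u : ℝ → E) : Prop where
  continuous : Continuous u
  hasDerivAt : ∀ i, ∀ s ∈ Set.Ioo (t i) (t (i + 1)), HasDerivAt u (F s (u s) (u (γ s))) s
  hasDerivWithinAt_right : ∀ i,
    HasDerivWithinAt u (F (t i) (u (t i)) (u (γ (t i)))) (Set.Ici (t i)) (t i)
  exists_left_deriv : ∀ i, ∃ w, HasDerivWithinAt u w (Set.Iic (t i)) (t i)

/-- Right-hand side of the linear system `y'(s) = A(s) y(s) + A₀(s) y(γ(s))`. -/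
def linearRHS (A A₀ : ℝ → E →L[ℝ] E) : ℝ → E → E → E :=
  fun s x y => A s x + A₀ s y

/-- Right-hand side of the system `x'(s) = A(s) x(s) + A₀(s) x(γ(s)) + f(s, x(s), x(γ(s)))`. -/
def perturbedRHS (A A₀ : ℝ → E →L[ℝ] E) (f : ℝ → E → E → E) : ℝ → E → E → E :=
  fun s x y => A s x + A₀ s y + f s x y

/-- Condition (A), together with continuity of `A`, `A₀` and `f` (for `f`, continuity in the time
variable; with the Lipschitz condition this is joint continuity). -/
structure ConditionA (A A₀ : ℝ → E →L[ℝ] E) (f : ℝ → E → E → E) (M M₀ μ ℓ₁ ℓ₂ : ℝ) : Prop where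
  continuous_A : Continuous A
  continuous_A₀ : Continuous A₀
  continuous_f : ∀ x y, Continuous fun s => f s x y
  M_pos : 0 < M
  M₀_pos : 0 < M₀
  norm_A_le : ∀ s, ‖A s‖ ≤ M
  norm_A₀_le : ∀ s, ‖A₀ s‖ ≤ M₀
  μ_pos : 0 < μ
  norm_f_le : ∀ s x y, ‖f s x y‖ ≤ μ
  ℓ₁_pos : 0 < ℓ₁
  ℓ₂_pos : 0 < ℓ₂
  lipschitz_f : ∀ s x x' y y', ‖f s x y - f s x' y'‖ ≤ ℓ₁ * ‖x - x'‖ + ℓ₂ * ‖y - y'‖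

/-- `ρₖ⁺(Q) = exp (∫_{t k}^{ζ k} |Q|)`. -/
noncomputable def rhoPlus (t ζ : ℤ → ℝ) (Q : ℝ → E →L[ℝ] E) (k : ℤ) : ℝ :=
  Real.exp (∫ s in (t k)..(ζ k), ‖Q s‖)

/-- `ρₖ⁻(Q) = exp (∫_{ζ k}^{t (k+1)} |Q|)`. -/
noncomputable def rhoMinus (t ζ : ℤ → ℝ) (Q : ℝ → E →L[ℝ] E) (k : ℤ) : ℝ :=
  Real.exp (∫ s in (ζ k)..(t (k + 1)), ‖Q s‖)

/-- `ρ(Q) = sup_k ρₖ⁺(Q) ρₖ⁻(Q)` (finite for bounded continuous `Q` under condition (B)). -/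
noncomputable def rho (t ζ : ℤ → ℝ) (Q : ℝ → E →L[ℝ] E) : ℝ :=
  ⨆ k : ℤ, rhoPlus t ζ Q k * rhoMinus t ζ Q k

/-- Condition (C). -/
def ConditionC (t ζ : ℤ → ℝ) (A A₀ : ℝ → E →L[ℝ] E) : Prop :=
  (∃ ν : ℝ, 0 < ν ∧ ν < 1 ∧ ∀ k, rhoPlus t ζ A k * Real.log (rhoPlus t ζ A₀ k) ≤ ν) ∧
  (∃ ν : ℝ, 0 < ν ∧ ν < 1 ∧ ∀ k, rhoMinus t ζ A k * Real.log (rhoMinus t ζ A₀ k) ≤ ν)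

open Classical in
/-- The transition matrix `Z(s, τ)` of the linear DEPCAG: the unique linear map that sends `z(τ)`
to `z(s)` for every solution `z`. (It exists as soon as through every `ξ` at time `τ` there passes
exactly one solution, which is the case under conditions (A), (B), (C).) -/
noncomputable def transition (t : ℤ → ℝ) (γ : ℝ → ℝ) (A A₀ : ℝ → E →L[ℝ] E) (s τ : ℝ) :
    E →L[ℝ] E :=
  if H : ∃! T : E →L[ℝ] E, ∀ z : ℝ → E, IsSolution t γ (linearRHS A A₀) z → z s = T (z τ)
  then H.choose else 0

/-- `Z_p(s, τ)`, equal to `Z(s,0) P Z(0,τ)` if `s ≥ τ` and to `- Z(s,0) (I - P) Z(0,τ)` if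
`τ > s`. -/
noncomputable def dichotomyKernel (t : ℤ → ℝ) (γ : ℝ → ℝ) (A A₀ : ℝ → E →L[ℝ] E)
    (P : E →L[ℝ] E) (s τ : ℝ) : E →L[ℝ] E :=
  if τ ≤ s then transition t γ A A₀ s 0 ∘L P ∘L transition t γ A A₀ 0 τ
  else -(transition t γ A A₀ s 0 ∘L (ContinuousLinearMap.id ℝ E - P) ∘L transition t γ A A₀ 0 τ)

/-- The linear DEPCAG has an `α`-exponential dichotomy on `ℝ` with constants `K`, `α`. -/
def ExpDichotomy (t : ℤ → ℝ) (γ : ℝ → ℝ) (A A₀ : ℝ → E →L[ℝ] E) (K α : ℝ) : Prop :=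
  1 ≤ K ∧ 0 < α ∧ ∃ P : E →L[ℝ] E, P ∘L P = P ∧
    ∀ s τ, ‖dichotomyKernel t γ A A₀ P s τ‖ ≤ K * Real.exp (-α * |s - τ|)

/-- `(exp (a θ) - 1) / (a θ)`; this is `F₁(θ)` for `a = M + ℓ₁` and `F₀(θ)` for `a = M`. -/
noncomputable def expQuot (a θ : ℝ) : ℝ := (Real.exp (a * θ) - 1) / (a * θ)

/-- `v = F₁(θ) (M₀ + ℓ₂) θ`. -/
noncomputable def vConst (M M₀ ℓ₁ ℓ₂ θ : ℝ) : ℝ := expQuot (M + ℓ₁) θ * (M₀ + ℓ₂) * θ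

/-- `ṽ = F₀(θ) M₀ θ`. -/
noncomputable def vTilde (M M₀ θ : ℝ) : ℝ := expQuot M θ * M₀ * θ

/-- Hypotheses for strong topological equivalence with the linear system, with explicit
constants. -/
structure StrongHypWith (t ζ : ℤ → ℝ) (γ : ℝ → ℝ) (A A₀ : ℝ → E →L[ℝ] E) (f : ℝ → E → E → E)
    (M M₀ μ ℓ₁ ℓ₂ θ K α : ℝ) : Prop where
  condA : ConditionA A A₀ f M M₀ μ ℓ₁ ℓ₂
  condB : ConditionB t ζ γ θ
  condC : ConditionC t ζ A A₀
  dichotomy : ExpDichotomy t γ A A₀ K α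
  small : 2 * (ℓ₁ + ℓ₂) * K * (rho t ζ A * Real.exp (α * θ)) < α
  v_lt_one : vConst M M₀ ℓ₁ ℓ₂ θ < 1
  vTilde_lt_one : vTilde M M₀ θ < 1

/-- The perturbation `f` of the linear system given by `A`, `A₀` satisfies the hypotheses for
strong topological equivalence, for some constants. -/
def StrongHyp (t ζ : ℤ → ℝ) (γ : ℝ → ℝ) (A A₀ : ℝ → E →L[ℝ] E) (f : ℝ → E → E → E) : Prop :=
  ∃ M M₀ μ ℓ₁ ℓ₂ θ K α : ℝ, StrongHypWith t ζ γ A A₀ f M M₀ μ ℓ₁ ℓ₂ θ K α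

/-- The perturbation `f` satisfies the hypotheses for Hölder strong topological equivalence, for
some constants. -/
def HolderHyp (t ζ : ℤ → ℝ) (γ : ℝ → ℝ) (A A₀ : ℝ → E →L[ℝ] E) (f : ℝ → E → E → E) : Prop :=
  ∃ M M₀ μ ℓ₁ ℓ₂ θ K α : ℝ, StrongHypWith t ζ γ A A₀ f M M₀ μ ℓ₁ ℓ₂ θ K α ∧
    α < M + min
      (ℓ₁ + (M₀ + ℓ₂) / (1 - vConst M M₀ ℓ₁ ℓ₂ θ) * Real.exp ((M + ℓ₁) * θ))
      (M₀ / (1 - vTilde M M₀ θ) * Real.exp (M * θ))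

/-- One direction of a topological equivalence: each `H s` is a homeomorphism of `E`,
`H s u - u` is bounded on `ℝ × E`, and `H` carries solutions of the system with right-hand side
`F` to solutions of the system with right-hand side `G`. -/
structure IsTopEquivMap (t : ℤ → ℝ) (γ : ℝ → ℝ) (F G : ℝ → E → E → E) (H : ℝ → E → E) : Prop where
  isHomeomorph : ∀ s, IsHomeomorph (H s)
  bounded : ∃ C : ℝ, ∀ s u, ‖H s u - u‖ ≤ C
  map_solution : ∀ x : ℝ → E, IsSolution t γ F x → IsSolution t γ G fun s => H s (x s)

/-- `H` realizes a topological equivalence of the systems with right-hand sides `F` and `G`, and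
`L s` is the inverse of `H s`, which has the same properties with `F` and `G` exchanged. -/
structure IsTopEquivPair (t : ℤ → ℝ) (γ : ℝ → ℝ) (F G : ℝ → E → E → E) (H L : ℝ → E → E) :
    Prop where
  fwd : IsTopEquivMap t γ F G H
  bwd : IsTopEquivMap t γ G F L
  left_inv : ∀ s, Function.LeftInverse (L s) (H s)
  right_inv : ∀ s, Function.RightInverse (L s) (H s)

/-- `u ↦ H s u` is uniformly continuous, uniformly in `s`. -/
def UnifContAllTimes (H : ℝ → E → E) : Prop :=
  ∀ ε > 0, ∃ δ > 0, ∀ s u u', ‖u - u'‖ < δ → ‖H s u - H s u'‖ < ε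

/-- `|H s u - H s u'| ≤ C |u - u'| ^ c` whenever `|u - u'| < 1`, for some `C > 1` and
`c ∈ (0, 1)` that do not depend on `s`. -/
def HolderAllTimes (H : ℝ → E → E) : Prop :=
  ∃ C c : ℝ, 1 < C ∧ c ∈ Set.Ioo (0 : ℝ) 1 ∧
    ∀ s u u', ‖u - u'‖ < 1 → ‖H s u - H s u'‖ ≤ C * ‖u - u'‖ ^ c

/-- Strong topological equivalence. -/
def StronglyTopEquiv (t : ℤ → ℝ) (γ : ℝ → ℝ) (F G : ℝ → E → E → E) : Prop :=
  ∃ H L : ℝ → E → E, IsTopEquivPair t γ F G H L ∧ UnifContAllTimes H ∧ UnifContAllTimes L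

/-- Hölder strong topological equivalence. -/
def HolderStronglyTopEquiv (t : ℤ → ℝ) (γ : ℝ → ℝ) (F G : ℝ → E → E → E) : Prop :=
  ∃ H L : ℝ → E → E, IsTopEquivPair t γ F G H L ∧ UnifContAllTimes H ∧ UnifContAllTimes L ∧
    HolderAllTimes H ∧ HolderAllTimes L

end DEPCAG

/-! The two perturbed systems are compared directly, without passing through the linear one. If `x`
solves the system with `f` and `y` the one with `h`, then `w = y - x` solves the linear system with
the bounded inhomogeneity `h(s, y, y(γ)) - f(s, x, x(γ))`. The dichotomy yields a bounded solution
operator for such problems (`exists_bounded`), of norm at most `2Kρ(A)e^{αθ}/α`. The smallness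
condition therefore makes the equation for `w` a contraction on bounded continuous functions, so
every `x` has a companion `y` at bounded distance (`exists_near`). The map `H` sends `x(s)` to
`y(s)`, and `L` is the same construction with the roles exchanged.

Uniqueness of the companion and regularity of `H` come together from `norm_sub_le_rpow`. Solutions
of the `f`-system separate at most like `e^{p|s - t₀|}`. Since `f` and `h` are both bounded and
Lipschitz, their increments are bounded by a multiple of the `c`-th power of the separation for
every `c` in `(0, 1]`. With `c = η/p` this source grows only like `e^{η|s - t₀|}`, and for small `η
< α` the linear estimate survives in that exponentially weighted norm (`norm_le_of_tendsto`). So `H`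
is Hölder uniformly in time, and equal initial values give equal companions. Uniqueness shows that
`H` and `L` are inverse to each other; uniform continuity follows from the Hölder bound.

The linear estimate needs the constant of the smallness condition exactly, wherever the switching
points lie. On each interval one subtracts the solution `b k` of `b' = A b + g` vanishing at `ζ k`;
the rest solves the homogeneous system there, delayed term included. Pulled back to time `0`,
solutions then jump by explicit increments, whose stable parts are summed over the past and unstable
parts over the future by telescoping; `switching_cost_le` adds the cost of the current interval. -/

namespace DEPCAG

open Set Filter Topology

/-! ### Grönwall inequalities on both sides of the initial time. -/

section Gronwall

variable {E : Type*} [NormedAddCommGroup E] [NormedSpace ℝ E]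

lemma hasDerivWithinAt_comp_neg {y : ℝ → E} {w : E} {p q s : ℝ}
    (h : HasDerivWithinAt y w (Icc p q) (-s)) :
    HasDerivWithinAt (fun r => y (-r)) (-w) (Icc (-q) (-p)) s := by
  have := HasDerivWithinAt.scomp s h (hasDerivAt_neg s).hasDerivWithinAt
    (s := Icc (-q) (-p)) (fun r hr => ⟨by linarith [hr.2], by linarith [hr.1]⟩)
  simpa [Function.comp_def] using this

lemma hasDerivWithinAt_Ici_of_Icc {y : ℝ → E} {w : E} {p q s : ℝ}
    (h : HasDerivWithinAt y w (Icc p q) s) (hs : s ∈ Ico p q) :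
    HasDerivWithinAt y w (Ici s) s :=
  h.mono_of_mem_nhdsWithin (mem_of_superset (Icc_mem_nhdsGE hs.2)
    (Icc_subset_Icc_left hs.1))

/-- Grönwall's inequality with a constant coefficient, on both sides of the initial time. -/
lemma norm_le_gronwallBound_of_mem_Icc {y y' : ℝ → E} {p q a G δ τ : ℝ}
    (hy : ∀ s ∈ Icc p q, HasDerivWithinAt y (y' s) (Icc p q) s)
    (hb : ∀ s ∈ Icc p q, ‖y' s‖ ≤ a * ‖y s‖ + G) (hτ : τ ∈ Icc p q) (hδ : ‖y τ‖ ≤ δ)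
    {s : ℝ} (hs : s ∈ Icc p q) : ‖y s‖ ≤ gronwallBound δ a G |s - τ| := by
  have key : ∀ {y y' : ℝ → E} {p q τ s : ℝ},
      (∀ s ∈ Icc p q, HasDerivWithinAt y (y' s) (Icc p q) s) →
      (∀ s ∈ Icc p q, ‖y' s‖ ≤ a * ‖y s‖ + G) → τ ∈ Icc p q → ‖y τ‖ ≤ δ → s ∈ Icc p q →
      τ ≤ s → ‖y s‖ ≤ gronwallBound δ a G |s - τ| := by
    intro y y' p q τ s hy hb hτ hδ hs hτs
    rw [abs_of_nonneg (sub_nonneg.2 hτs)]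
    refine norm_le_gronwallBound_of_norm_deriv_right_le (b := q) (f' := y')
      (fun r hr => (hy r ⟨hτ.1.trans hr.1, hr.2⟩).continuousWithinAt.mono
        (Icc_subset_Icc_left hτ.1))
      (fun r hr => hasDerivWithinAt_Ici_of_Icc (hy r ⟨hτ.1.trans hr.1, hr.2.le⟩)
        ⟨hτ.1.trans hr.1, hr.2⟩) hδ
      (fun r hr => hb r ⟨hτ.1.trans hr.1, hr.2.le⟩) s ⟨hτs, hs.2⟩
  rcases le_total τ s with h | h
  · exact key hy hb hτ hδ hs h
  -- Reversal of time reduces the past to the future.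
  · have := key (y := fun r => y (-r)) (y' := fun r => -y' (-r)) (p := -q) (q := -p)
      (τ := -τ) (s := -s)
      (fun r hr => hasDerivWithinAt_comp_neg (hy (-r) ⟨by linarith [hr.2], by linarith [hr.1]⟩))
      (fun r hr => by
        simpa using hb (-r) ⟨by linarith [hr.2], by linarith [hr.1]⟩)
      ⟨by linarith [hτ.2], by linarith [hτ.1]⟩ (by simpa using hδ)
      ⟨by linarith [hs.2], by linarith [hs.1]⟩ (by linarith)
    simpa [neg_add_eq_sub, abs_sub_comm] using this

/-- Grönwall's inequality with a variable coefficient for functions that vanish at the initial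
time, on both sides of it. -/
lemma norm_le_mul_exp_integral {y y' : ℝ → E} {a : ℝ → ℝ} {p q G τ : ℝ}
    (ha : Continuous a) (ha0 : ∀ s, 0 ≤ a s)
    (hy : ∀ s ∈ Icc p q, HasDerivWithinAt y (y' s) (Icc p q) s)
    (hb : ∀ s ∈ Icc p q, ‖y' s‖ ≤ a s * ‖y s‖ + G) (hτ : τ ∈ Icc p q) (h0 : y τ = 0)
    {s : ℝ} (hs : s ∈ Icc p q) : ‖y s‖ ≤ G * |s - τ| * Real.exp (∫ r in p..q, a r) := by
  have key : ∀ {y y' : ℝ → E} {a : ℝ → ℝ} {p q τ s : ℝ}, Continuous a → (∀ s, 0 ≤ a s) →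
      (∀ s ∈ Icc p q, HasDerivWithinAt y (y' s) (Icc p q) s) →
      (∀ s ∈ Icc p q, ‖y' s‖ ≤ a s * ‖y s‖ + G) → τ ∈ Icc p q → y τ = 0 → s ∈ Icc p q →
      τ ≤ s → ‖y s‖ ≤ G * |s - τ| * Real.exp (∫ r in p..q, a r) := by
    intro y y' a p q τ s ha ha0 hy hb hτ h0 hs hτs
    rw [abs_of_nonneg (sub_nonneg.2 hτs)]
    have hG : 0 ≤ G := by
      have := hb τ hτ
      rw [h0, norm_zero, mul_zero, zero_add] at this
      exact (norm_nonneg _).trans this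
    -- The barrier `(G + ε)(x - τ)e(x)` has derivative `a` times itself plus `(G + ε)e(x)`, and `e ≥
    -- 1`; the slack `ε` gives the strict inequality that the comparison principle requires at a
    -- contact point.
    have hε : ∀ ε > 0, ‖y s‖ ≤ (G + ε) * ((s - τ) * Real.exp (∫ r in p..q, a r)) := by
      intro ε hε
      set e : ℝ → ℝ := fun x => Real.exp (∫ r in τ..x, a r) with he
      have hde : ∀ x, HasDerivAt e (e x * a x) x := fun x =>
        (ha.integral_hasStrictDerivAt τ x).hasDerivAt.exp
      have hB : ∀ x, HasDerivAt (fun x => (G + ε) * ((x - τ) * e x))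
          ((G + ε) * (1 * e x + (x - τ) * (e x * a x))) x := fun x =>
        (((hasDerivAt_id x).sub_const τ).mul (hde x)).const_mul (G + ε)
      have hmain := image_norm_le_of_norm_deriv_right_lt_deriv_boundary (a := τ) (b := q)
        (f' := y')
        (fun r hr => (hy r ⟨hτ.1.trans hr.1, hr.2⟩).continuousWithinAt.mono
          (Icc_subset_Icc_left hτ.1))
        (fun r hr => hasDerivWithinAt_Ici_of_Icc (hy r ⟨hτ.1.trans hr.1, hr.2.le⟩)
          ⟨hτ.1.trans hr.1, hr.2⟩) (by simp [h0]) hB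
        (fun r hr hr' => by
          have h1 := hb r ⟨hτ.1.trans hr.1, hr.2.le⟩
          rw [hr'] at h1
          have h2 : 1 ≤ e r := Real.one_le_exp
            (intervalIntegral.integral_nonneg hr.1 fun u _ => ha0 u)
          nlinarith)
        (x := s) ⟨hτs, hs.2⟩
      have hes : e s ≤ Real.exp (∫ r in p..q, a r) := Real.exp_le_exp.2 <| by
        exact intervalIntegral.integral_mono_interval hτ.1 hτs hs.2
          (Eventually.of_forall ha0) (ha.intervalIntegrable _ _)
      have := sub_nonneg.2 hτs
      exact hmain.trans (by gcongr)
    have hlim : Tendsto (fun ε : ℝ => (G + ε) * ((s - τ) * Real.exp (∫ r in p..q, a r)))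
        (𝓝[>] 0) (𝓝 ((G + 0) * ((s - τ) * Real.exp (∫ r in p..q, a r)))) :=
      (Continuous.tendsto (by fun_prop) 0).mono_left nhdsWithin_le_nhds
    have := ge_of_tendsto hlim (eventually_mem_nhdsWithin.mono hε)
    simpa [mul_assoc] using this
  rcases le_total τ s with h | h
  · exact key ha ha0 hy hb hτ h0 hs h
  · have := key (y := fun r => y (-r)) (y' := fun r => -y' (-r)) (a := fun r => a (-r))
      (p := -q) (q := -p) (τ := -τ) (s := -s) (by fun_prop) (fun _ => ha0 _)
      (fun r hr => hasDerivWithinAt_comp_neg (hy (-r) ⟨by linarith [hr.2], by linarith [hr.1]⟩))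
      (fun r hr => by
        simpa using hb (-r) ⟨by linarith [hr.2], by linarith [hr.1]⟩)
      ⟨by linarith [hτ.2], by linarith [hτ.1]⟩ (by simpa using h0)
      ⟨by linarith [hs.2], by linarith [hs.1]⟩ (by linarith)
    simpa [neg_add_eq_sub, abs_sub_comm] using this

end Gronwall

/-! ### Global solvability of Lipschitz ordinary differential equations. -/

section GlobalExistence

variable {E : Type*} [NormedAddCommGroup E] [NormedSpace ℝ E]

lemma continuous_comp_of_lipschitz {E : Type*} [NormedAddCommGroup E] {F : ℝ → E → E} {L : ℝ}
    (hF : ∀ x, Continuous fun s => F s x) (hL : ∀ s x x', ‖F s x - F s x'‖ ≤ L * ‖x - x'‖)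
    {u : ℝ → E} {S : Set ℝ} (hu : ContinuousOn u S) : ContinuousOn (fun s => F s (u s)) S := by
  intro s hs
  have h1 : Tendsto (fun r => F r (u s)) (𝓝[S] s) (𝓝 (F s (u s))) :=
    ((hF (u s)).tendsto s).mono_left nhdsWithin_le_nhds
  have h2 : Tendsto (fun r => F r (u r) - F r (u s)) (𝓝[S] s) (𝓝 0) := by
    refine squeeze_zero_norm (fun r => hL r (u r) (u s)) ?_
    have : Tendsto (fun r => L * ‖u r - u s‖) (𝓝[S] s) (𝓝 (L * ‖u s - u s‖)) :=
      (((hu s hs).sub tendsto_const_nhds).norm).const_mul L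
    simpa using this
  have h3 := h2.add h1
  simp only [zero_add] at h3
  exact h3.congr fun r => by abel

lemma norm_integral_le_exp_abs {φ : ℝ → E} {D c τ : ℝ} (hc : 0 < c) (hD : 0 ≤ D)
    (h : ∀ r, ‖φ r‖ ≤ D * Real.exp (c * |r - τ|)) (s : ℝ) :
    ‖∫ r in τ..s, φ r‖ ≤ D / c * Real.exp (c * |s - τ|) := by
  have hval : ∀ x : ℝ, ∫ r in (0 : ℝ)..x, D * Real.exp (c * r) = D / c * (Real.exp (c * x) - 1) := by
    intro x
    rw [intervalIntegral.integral_eq_sub_of_hasDerivAt (f := fun r => D / c * Real.exp (c * r))]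
    · simp; ring
    · intro r _
      have := (((hasDerivAt_id r).const_mul c).exp).const_mul (D / c)
      refine this.congr_deriv ?_
      simp; field_simp
    · exact (Continuous.intervalIntegrable (by fun_prop) _ _)
  have hfin : ∀ x : ℝ, D / c * (Real.exp (c * x) - 1) ≤ D / c * Real.exp (c * x) := fun x => by
    have : 0 ≤ D / c := by positivity
    nlinarith
  rcases le_total τ s with hs | hs
  · have h1 : ‖∫ r in τ..s, φ r‖ ≤ ∫ r in τ..s, D * Real.exp (c * (r - τ)) :=
      intervalIntegral.norm_integral_le_of_norm_le hs
        (Eventually.of_forall fun r hr => by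
          simpa [abs_of_nonneg (sub_nonneg.2 hr.1.le)] using h r)
        (Continuous.intervalIntegrable (by fun_prop) _ _)
    rw [intervalIntegral.integral_comp_sub_right (fun r => D * Real.exp (c * r)), sub_self,
      hval] at h1
    rw [abs_of_nonneg (sub_nonneg.2 hs)]
    exact h1.trans (hfin _)
  · rw [intervalIntegral.integral_symm, norm_neg]
    have h1 : ‖∫ r in s..τ, φ r‖ ≤ ∫ r in s..τ, D * Real.exp (c * (τ - r)) :=
      intervalIntegral.norm_integral_le_of_norm_le hs
        (Eventually.of_forall fun r hr => by
          simpa [abs_sub_comm r τ, abs_of_nonneg (sub_nonneg.2 hr.2)] using h r)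
        (Continuous.intervalIntegrable (by fun_prop) _ _)
    rw [intervalIntegral.integral_comp_sub_left (fun r => D * Real.exp (c * r)), sub_self,
      hval] at h1
    rw [abs_sub_comm, abs_of_nonneg (sub_nonneg.2 hs)]
    exact h1.trans (hfin _)

open BoundedContinuousFunction in
/-- Global existence for a Lipschitz ordinary differential equation. -/
lemma exists_hasDerivAt_of_lipschitz [CompleteSpace E] {F : ℝ → E → E} {L C : ℝ} (hL0 : 0 < L)
    (hF : ∀ x, Continuous fun s => F s x) (hL : ∀ s x x', ‖F s x - F s x'‖ ≤ L * ‖x - x'‖)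
    (hC : ∀ s, ‖F s 0‖ ≤ C) (τ : ℝ) (ξ : E) :
    ∃ y : ℝ → E, y τ = ξ ∧ ∀ s, HasDerivAt y (F s (y s)) s := by
  have hC0 : 0 ≤ C := (norm_nonneg _).trans (hC 0)
  -- In the sup norm weighted by `e^{-c|s - τ|}`, integration from `τ` costs a factor `1/c`, so the
  -- Picard operator contracts by `L/c = 1/2` on the whole line at once. The unknown `u` is the
  -- solution divided by the weight.
  set c : ℝ := 2 * L with hc
  have hc0 : 0 < c := by positivity
  set e : ℝ → ℝ := fun s => Real.exp (c * |s - τ|) with he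
  have he1 : ∀ s, 1 ≤ e s := fun s => Real.one_le_exp (by positivity)
  have hec : Continuous e := by fun_prop
  have hFu : ∀ u : ℝ → E, Continuous u → Continuous fun s => F s (u s) := fun u hu =>
    continuousOn_univ.1 (continuous_comp_of_lipschitz hF hL hu.continuousOn)
  have hint : ∀ u : ℝ → E, Continuous u → ∀ s,
      HasDerivAt (fun s => ξ + ∫ r in τ..s, F r (u r)) (F s (u s)) s := fun u hu s =>
    (((hFu u hu).integral_hasStrictDerivAt τ s).hasDerivAt).const_add ξ
  have hcont : ∀ u : ℝ →ᵇ E, Continuous fun s => e s • u s := fun u => hec.smul u.continuous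
  have hbd : ∀ u : ℝ →ᵇ E, ∀ r, ‖F r (e r • u r)‖ ≤ (C + L * ‖u‖) * e r := by
    intro u r
    have h1 := hL r (e r • u r) 0
    have h2 := norm_le_norm_add_norm_sub' (F r (e r • u r)) (F r 0)
    rw [sub_zero, norm_smul, Real.norm_of_nonneg (zero_le_one.trans (he1 r))] at h1
    have h3 : L * (e r * ‖u r‖) ≤ L * (e r * ‖u‖) := by
      have := u.norm_coe_le_norm r
      have := he1 r
      gcongr
    have := hC r
    nlinarith [he1 r]
  let T : (ℝ →ᵇ E) → (ℝ →ᵇ E) := fun u =>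
    ofNormedAddCommGroup (fun s => (e s)⁻¹ • (ξ + ∫ r in τ..s, F r (e r • u r)))
      ((hec.inv₀ fun s => (zero_lt_one.trans_le (he1 s)).ne').smul
        (continuous_iff_continuousAt.2 fun s => (hint _ (hcont u) s).continuousAt))
      (‖ξ‖ + (C + L * ‖u‖) / c) (by
        intro s
        have hes : 0 < e s := zero_lt_one.trans_le (he1 s)
        rw [norm_smul, norm_inv, Real.norm_of_nonneg hes.le, inv_mul_le_iff₀ hes]
        have h1 := norm_integral_le_exp_abs (τ := τ) hc0 (by positivity) (hbd u) s
        have h2 := norm_add_le ξ (∫ r in τ..s, F r (e r • u r))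
        have h3 : ‖ξ‖ ≤ e s * ‖ξ‖ := le_mul_of_one_le_left (norm_nonneg _) (he1 s)
        calc _ ≤ _ := h2
          _ ≤ e s * ‖ξ‖ + (C + L * ‖u‖) / c * e s := add_le_add h3 h1
          _ = _ := by ring)
  have hT : ContractingWith (1 / 2) T := by
    refine ⟨by norm_num, LipschitzWith.of_dist_le_mul fun u v => ?_⟩
    rw [BoundedContinuousFunction.dist_le (by positivity)]
    intro s
    have hes : 0 < e s := zero_lt_one.trans_le (he1 s)
    have hsub : T u s - T v s
        = (e s)⁻¹ • ∫ r in τ..s, (F r (e r • u r) - F r (e r • v r)) := by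
      rw [intervalIntegral.integral_sub ((hFu _ (hcont u)).intervalIntegrable _ _)
        ((hFu _ (hcont v)).intervalIntegrable _ _)]
      change (e s)⁻¹ • (ξ + ∫ r in τ..s, F r (e r • u r)) -
        (e s)⁻¹ • (ξ + ∫ r in τ..s, F r (e r • v r)) = _
      rw [← smul_sub, add_sub_add_left_eq_sub]
    rw [dist_eq_norm, hsub, norm_smul, norm_inv, Real.norm_of_nonneg hes.le,
      inv_mul_le_iff₀ hes]
    have h1 := norm_integral_le_exp_abs (τ := τ) (D := L * dist u v) hc0 (by positivity)
      (φ := fun r => F r (e r • u r) - F r (e r • v r)) (fun r => by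
        refine (hL r _ _).trans ?_
        rw [← smul_sub, norm_smul, Real.norm_of_nonneg (zero_le_one.trans (he1 r)),
          ← dist_eq_norm]
        have := u.dist_coe_le_dist (g := v) r
        have h4 := he1 r
        calc L * (e r * dist (u r) (v r)) ≤ L * (e r * dist u v) := by gcongr
          _ = _ := by ring) s
    refine h1.trans (le_of_eq ?_)
    rw [hc]
    simp only [he, hc]
    push_cast
    field_simp
  set u := hT.fixedPoint T with hu
  have hfix : ∀ s, e s • u s = ξ + ∫ r in τ..s, F r (e r • u r) := by
    intro s
    have h1 : T u = u := hT.fixedPoint_isFixedPt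
    have hes : 0 < e s := zero_lt_one.trans_le (he1 s)
    conv_lhs => rw [← h1]
    exact smul_inv_smul₀ hes.ne' _
  refine ⟨fun s => e s • u s, by simp [hfix τ], fun s => ?_⟩
  exact (hint _ (hcont u) s).congr_of_eventuallyEq (Eventually.of_forall hfix)

end GlobalExistence

/-! ### The partition of the line: gluing, two-sided recursion, chaining of bounds. -/

section Partition

variable {E : Type*} [NormedAddCommGroup E] [NormedSpace ℝ E] {t ζ : ℤ → ℝ} {γ : ℝ → ℝ} {θ : ℝ}

lemma ConditionB.strictMono (hB : ConditionB t ζ γ θ) : StrictMono t :=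
  strictMono_int_of_lt_succ hB.lt_succ

lemma ConditionB.exists_mem_Ico (hB : ConditionB t ζ γ θ) (s : ℝ) :
    ∃ k, s ∈ Ico (t k) (t (k + 1)) := by
  obtain ⟨m, hm⟩ := (hB.tendsto_bot.eventually_le_atBot s).exists
  obtain ⟨n, hn⟩ := (hB.tendsto_top.eventually_gt_atTop s).exists
  obtain ⟨k, hk, hmax⟩ := Int.exists_greatest_of_bdd (P := fun k => t k ≤ s)
    ⟨n, fun z hz => (hB.strictMono.lt_iff_lt.1 (hz.trans_lt hn)).le⟩ ⟨m, hm⟩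
  refine ⟨k, hk, lt_of_not_ge fun h => ?_⟩
  have := hmax _ h
  omega

lemma ConditionB.eq_of_mem_Ico (hB : ConditionB t ζ γ θ) {s : ℝ} {j k : ℤ}
    (hj : s ∈ Ico (t j) (t (j + 1))) (hk : s ∈ Ico (t k) (t (k + 1))) : j = k := by
  have h1 := hB.strictMono.lt_iff_lt.1 (hj.1.trans_lt hk.2)
  have h2 := hB.strictMono.lt_iff_lt.1 (hk.1.trans_lt hj.2)
  omega

lemma ConditionB.mem_left (hB : ConditionB t ζ γ θ) (k : ℤ) : t k ∈ Icc (t k) (t (k + 1)) :=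
  ⟨le_rfl, (hB.lt_succ k).le⟩

lemma ConditionB.mem_right (hB : ConditionB t ζ γ θ) (k : ℤ) :
    t (k + 1) ∈ Icc (t k) (t (k + 1)) :=
  ⟨(hB.lt_succ k).le, le_rfl⟩

lemma ConditionB.abs_sub_le (hB : ConditionB t ζ γ θ) {k : ℤ} {s r : ℝ}
    (hs : s ∈ Icc (t k) (t (k + 1))) (hr : r ∈ Icc (t k) (t (k + 1))) : |s - r| ≤ θ := by
  have := hB.gap_le k
  rw [abs_le]
  constructor <;> linarith [hs.1, hs.2, hr.1, hr.2]

/-- Functions on consecutive intervals that agree at the common endpoints fit together. -/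
lemma ConditionB.exists_glue {X : Type*} (hB : ConditionB t ζ γ θ) (y : ℤ → ℝ → X)
    (hy : ∀ k, y k (t (k + 1)) = y (k + 1) (t (k + 1))) :
    ∃ u : ℝ → X, ∀ k, EqOn u (y k) (Icc (t k) (t (k + 1))) := by
  choose κ hκ using hB.exists_mem_Ico
  refine ⟨fun s => y (κ s) s, fun k s hs => ?_⟩
  rcases hs.2.eq_or_lt with h | h
  · have : κ s = k + 1 := hB.eq_of_mem_Ico (hκ s) ⟨h.ge, h ▸ hB.lt_succ (k + 1)⟩
    simp only [this]
    rw [h, hy]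
  · simp only [hB.eq_of_mem_Ico (hκ s) ⟨hs.1, h⟩]

/-- Two recursions on `ℕ`, one in each direction from `k₀`, joined at their common starting value;
this is why the relation must be solvable from either end. -/
lemma exists_int_chain {X : Type*} {R : ℤ → X → X → Prop} (hf : ∀ k x, ∃ x', R k x x')
    (hb : ∀ k x', ∃ x, R k x x') (k₀ : ℤ) (x₀ : X) :
    ∃ x : ℤ → X, x k₀ = x₀ ∧ ∀ k, R k (x k) (x (k + 1)) := by
  choose f hf using hf
  choose g hg using hb
  let p : ℕ → X := fun n => Nat.rec x₀ (fun n x => f (k₀ + n) x) n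
  let q : ℕ → X := fun n => Nat.rec x₀ (fun n x => g (k₀ - n - 1) x) n
  have hp : ∀ n : ℕ, R (k₀ + n) (p n) (p (n + 1)) := fun n => hf _ _
  have hq : ∀ n : ℕ, R (k₀ - n - 1) (q (n + 1)) (q n) := fun n => hg _ _
  refine ⟨fun k => if k₀ ≤ k then p (k - k₀).toNat else q (k₀ - k).toNat, by simp [p], ?_⟩
  intro k
  rcases le_or_gt k₀ k with h | h
  · obtain ⟨n, rfl⟩ := Int.le.dest h
    have h1 : (k₀ + n + 1 - k₀).toNat = n + 1 := by omega
    have h2 : k₀ ≤ k₀ + n + 1 := by omega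
    simpa [h1, h2] using hp n
  · obtain ⟨n, hn⟩ := Int.le.dest (show k + 1 ≤ k₀ by omega)
    have hk : k = k₀ - n - 1 := by omega
    subst hk
    have h1 : (k₀ - (k₀ - n - 1)).toNat = n + 1 := by omega
    have h2 : ¬ k₀ ≤ k₀ - n - 1 := by omega
    rcases n with _ | n
    · have h0 : q 0 = p 0 := rfl
      simpa [h1, h0] using hq 0
    · have h3 : ¬ k₀ ≤ k₀ - (n + 1 : ℕ) - 1 + 1 := by omega
      have h4 : (k₀ - (k₀ - (n + 1 : ℕ) - 1 + 1)).toNat = n + 1 := by omega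
      simp only [h1, h2, h3, h4, if_false]
      exact hq (n + 1)

/-- An exponential two-sided bound on each interval of the partition holds globally. -/
lemma ConditionB.le_exp_mul (hB : ConditionB t ζ γ θ) {φ : ℝ → ℝ} {p : ℝ}
    (h : ∀ k, ∀ s ∈ Icc (t k) (t (k + 1)), ∀ τ ∈ Icc (t k) (t (k + 1)),
      φ s ≤ Real.exp (p * |s - τ|) * φ τ) (s τ : ℝ) : φ s ≤ Real.exp (p * |s - τ|) * φ τ := by
  have htrans : ∀ a b c : ℝ, |a - c| = |a - b| + |b - c| → φ a ≤ Real.exp (p * |a - b|) * φ b →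
      φ b ≤ Real.exp (p * |b - c|) * φ c → φ a ≤ Real.exp (p * |a - c|) * φ c := by
    intro a b c habc hab hbc
    rw [habc, mul_add, Real.exp_add, mul_assoc]
    exact hab.trans (by gcongr)
  -- Induction on the number of intervals between the two times. Distances add along monotone
  -- triples, so chaining leaves the rate unchanged; both directions are carried because either time
  -- may be the earlier one.
  have key : ∀ (n : ℕ) (k : ℤ), ∀ τ ∈ Icc (t k) (t (k + 1)),
      ∀ s ∈ Icc (t (k + n)) (t (k + n + 1)),
      φ s ≤ Real.exp (p * |s - τ|) * φ τ ∧ φ τ ≤ Real.exp (p * |τ - s|) * φ s := by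
    intro n k τ hτ
    induction n with
    | zero =>
      intro s hs
      simp only [Nat.cast_zero, add_zero] at hs
      exact ⟨h k s hs τ hτ, h k τ hτ s hs⟩
    | succ n ih =>
      intro s hs
      have hm := ih (t (k + n + 1)) (hB.mem_right _)
      have hs' : s ∈ Icc (t (k + n + 1)) (t (k + n + 1 + 1)) := by
        simpa [add_assoc] using hs
      have hτm : τ ≤ t (k + n + 1) :=
        hτ.2.trans (hB.strictMono.monotone (by omega))
      have e1 : |s - τ| = |s - t (k + n + 1)| + |t (k + n + 1) - τ| := by
        rw [abs_of_nonneg, abs_of_nonneg, abs_of_nonneg] <;> linarith [hs'.1]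
      refine ⟨htrans _ _ _ e1 (h _ s hs' _ (hB.mem_left _)) hm.1, htrans _ _ _ ?_ hm.2
        (h _ _ (hB.mem_left _) s hs')⟩
      rw [abs_sub_comm, e1, abs_sub_comm s, abs_sub_comm _ τ, add_comm]
  obtain ⟨j, hj⟩ := hB.exists_mem_Ico s
  obtain ⟨k, hk⟩ := hB.exists_mem_Ico τ
  rcases le_total k j with hjk | hjk
  · obtain ⟨n, rfl⟩ := Int.le.dest hjk
    exact (key n k τ ⟨hk.1, hk.2.le⟩ s ⟨hj.1, hj.2.le⟩).1
  · obtain ⟨n, rfl⟩ := Int.le.dest hjk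
    exact (key n j s ⟨hj.1, hj.2.le⟩ τ ⟨hk.1, hk.2.le⟩).2

end Partition

/-! ### Solutions interval by interval: growth, uniqueness, existence. -/

section Piecewise

variable {E : Type*} [NormedAddCommGroup E] [NormedSpace ℝ E] {t ζ : ℤ → ℝ} {γ : ℝ → ℝ} {θ : ℝ}

/-- `u` solves `u'(s) = F k s (u s) (u (ζ k))` on each closed interval `[t k, t (k + 1)]`, with
one-sided derivatives at the endpoints. -/
def PiecewiseSolution (t ζ : ℤ → ℝ) (F : ℤ → ℝ → E → E → E) (u : ℝ → E) : Prop :=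
  ∀ k, ∀ s ∈ Icc (t k) (t (k + 1)),
    HasDerivWithinAt u (F k s (u s) (u (ζ k))) (Icc (t k) (t (k + 1))) s

/-- `F` is continuous in time and Lipschitz in the two state variables, and `F k s 0 0` is
bounded. -/
structure LipschitzRHS (F : ℤ → ℝ → E → E → E) (a b : ℝ) : Prop where
  pos_a : 0 < a
  pos_b : 0 < b
  continuous : ∀ k x y, Continuous fun s => F k s x y
  lipschitz : ∀ k s x x' y y', ‖F k s x y - F k s x' y'‖ ≤ a * ‖x - x'‖ + b * ‖y - y'‖
  bounded : ∃ C, ∀ k s, ‖F k s 0 0‖ ≤ C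

lemma LipschitzRHS.continuousOn_comp {E : Type*} [NormedAddCommGroup E] {F : ℤ → ℝ → E → E → E} {a b : ℝ} (hF : LipschitzRHS F a b)
    {u : ℝ → E} {S : Set ℝ} (hu : ContinuousOn u S) (k : ℤ) (y : E) :
    ContinuousOn (fun s => F k s (u s) y) S :=
  continuous_comp_of_lipschitz (F := fun s x => F k s x y) (fun x => hF.continuous k x y)
    (fun s x x' => by simpa using hF.lipschitz k s x x' y y) hu

lemma PiecewiseSolution.continuous (hB : ConditionB t ζ γ θ) {F : ℤ → ℝ → E → E → E}
    {u : ℝ → E} (hu : PiecewiseSolution t ζ F u) : Continuous u := by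
  refine continuous_iff_continuousAt.2 fun s => ?_
  obtain ⟨k, hk⟩ := hB.exists_mem_Ico s
  rcases hk.1.eq_or_lt with h | h
  · have h1 : ContinuousWithinAt u (Iic s) s := by
      have := hu (k - 1) s (by
        rw [sub_add_cancel]; exact ⟨h ▸ (hB.strictMono (by omega)).le, h.ge⟩)
      refine this.continuousWithinAt.mono_of_mem_nhdsWithin ?_
      rw [sub_add_cancel, h]
      exact Icc_mem_nhdsLE (h ▸ hB.strictMono (by omega))
    have h2 : ContinuousWithinAt u (Ici s) s :=
      (hu k s ⟨hk.1, hk.2.le⟩).continuousWithinAt.mono_of_mem_nhdsWithin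
        (by rw [h]; exact Icc_mem_nhdsGE hk.2)
    exact continuousAt_iff_continuous_left_right.2 ⟨h1, h2⟩
  · exact (hu k s ⟨hk.1, hk.2.le⟩).continuousWithinAt.continuousAt (Icc_mem_nhds h hk.2)

lemma ConditionB.gamma_left (hB : ConditionB t ζ γ θ) (k : ℤ) : γ (t k) = ζ k :=
  hB.gamma_eq k _ ⟨le_rfl, hB.lt_succ k⟩

/-- The only delicate point is the right end of an interval, where `γ` has already jumped. There
`u'` has a limit from the left, computed with the old value `ζ k`, and that limit is the left
derivative. -/
lemma isSolution_iff_piecewise (hB : ConditionB t ζ γ θ) {F : ℝ → E → E → E} {a b : ℝ}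
    (hF : LipschitzRHS (fun _ => F) a b) {u : ℝ → E} :
    IsSolution t γ F u ↔ PiecewiseSolution t ζ (fun _ => F) u := by
  constructor
  · intro h k s hs
    have hder : ∀ r ∈ Ioo (t k) (t (k + 1)), HasDerivAt u (F r (u r) (u (ζ k))) r := fun r hr => by
      have := h.hasDerivAt k r hr
      rwa [hB.gamma_eq k r ⟨hr.1.le, hr.2⟩] at this
    rcases hs.1.eq_or_lt with hl | hl
    · have := h.hasDerivWithinAt_right k
      rw [hB.gamma_left] at this
      rw [← hl]
      exact this.mono Icc_subset_Ici_self
    rcases hs.2.eq_or_lt with hr | hr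
    · have hlt : t k < s := hl
      refine (hasDerivWithinAt_Iic_of_tendsto_deriv (s := Ioo (t k) s)
        (fun r hr' => (hder r ⟨hr'.1, hr ▸ hr'.2⟩).differentiableAt.differentiableWithinAt)
        h.continuous.continuousWithinAt (Ioo_mem_nhdsLT hl) ?_).mono
        (fun r hr' => hr'.2.trans hr.ge)
      have hc : Tendsto (fun r => F r (u r) (u (ζ k))) (𝓝[<] s) (𝓝 (F s (u s) (u (ζ k)))) :=
        ((hF.continuousOn_comp h.continuous.continuousOn (S := univ) 0 (u (ζ k))) s
          (mem_univ s)).mono_left (nhdsWithin_mono _ (subset_univ _))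
      refine hc.congr' ?_
      filter_upwards [Ioo_mem_nhdsLT hl] with r hr'
      exact (hder r ⟨hr'.1, hr ▸ hr'.2⟩).deriv.symm
    · exact (hder s ⟨hl, hr⟩).hasDerivWithinAt
  · intro h
    refine ⟨h.continuous hB, fun k s hs => ?_, fun k => ?_, fun k => ?_⟩
    · rw [hB.gamma_eq k s ⟨hs.1.le, hs.2⟩]
      exact (h k s ⟨hs.1.le, hs.2.le⟩).hasDerivAt (Icc_mem_nhds hs.1 hs.2)
    · rw [hB.gamma_left]
      exact hasDerivWithinAt_Ici_of_Icc (h k _ (hB.mem_left k)) ⟨le_rfl, hB.lt_succ k⟩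
    · refine ⟨_, (h (k - 1) (t k) ?_).mono_of_mem_nhdsWithin ?_⟩
      · simpa using hB.mem_right (k - 1)
      · rw [sub_add_cancel]
        exact Icc_mem_nhdsLE (hB.strictMono (by omega))

/-- Exponential growth rate of differences of solutions of a Lipschitz system. -/
noncomputable def growthRate (a b θ : ℝ) : ℝ :=
  (a + b) * (Real.exp (a * θ) / (1 - expQuot a θ * b * θ))

/-- The factor of `d` is the quantity that (S) requires to be less than `1`, so a delayed term of
size `d` can be absorbed. -/
lemma gronwallBound_le {a b θ δ d r : ℝ} (ha : 0 < a) (hb : 0 < b) (hδ : 0 ≤ δ)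
    (hd : 0 ≤ d) (hr0 : 0 ≤ r) (hr : r ≤ θ) :
    gronwallBound δ a (b * d) r ≤ δ * Real.exp (a * θ) + expQuot a θ * b * θ * d := by
  rcases (hr0.trans hr).eq_or_lt with h0 | hθ
  · have : r = 0 := by linarith
    simp [this, gronwallBound_x0, ← h0]
  refine (gronwallBound_mono hδ (by positivity) ha.le hr).trans (le_of_eq ?_)
  rw [gronwallBound_of_K_ne_0 ha.ne', expQuot]
  field_simp

lemma expQuot_mul_nonneg {a b θ : ℝ} (ha : 0 < a) (hb : 0 < b) (hθ : 0 < θ) :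
    0 ≤ expQuot a θ * b * θ := by
  have : 0 ≤ Real.exp (a * θ) - 1 := sub_nonneg.2 (Real.one_le_exp (by positivity))
  unfold expQuot
  positivity

lemma growthRate_pos {a b θ : ℝ} (ha : 0 < a) (hb : 0 < b) (hv : expQuot a θ * b * θ < 1) :
    0 < growthRate a b θ := by
  have : 0 < 1 - expQuot a θ * b * θ := by linarith
  unfold growthRate
  positivity

/-- Grönwall from `τ` bounds `d` by `e^{aθ}‖d τ‖ + v‖d z‖`. Evaluating at `z` and absorbing with `v
< 1` gives `‖d‖ ≤ D‖d τ‖` on the interval, hence a bound on `d'`; the mean value inequality and `1 +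
x ≤ e^x` finish. The result carries no prefactor, so it can be multiplied over consecutive
intervals. -/
lemma norm_le_exp_growthRate {a b p q z : ℝ} (ha : 0 < a) (hb : 0 < b)
    (hθ : 0 < θ) (hv : expQuot a θ * b * θ < 1) (hpq : q - p ≤ θ) (hz : z ∈ Icc p q)
    {d d' : ℝ → E} (hd : ∀ s ∈ Icc p q, HasDerivWithinAt d (d' s) (Icc p q) s)
    (hd' : ∀ s ∈ Icc p q, ‖d' s‖ ≤ a * ‖d s‖ + b * ‖d z‖) {s τ : ℝ} (hs : s ∈ Icc p q)
    (hτ : τ ∈ Icc p q) : ‖d s‖ ≤ Real.exp (growthRate a b θ * |s - τ|) * ‖d τ‖ := by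
  set v := expQuot a θ * b * θ with hvdef
  have hv0 : 0 < 1 - v := by linarith
  have hvn : 0 ≤ v := expQuot_mul_nonneg ha hb hθ
  set D := Real.exp (a * θ) / (1 - v) with hD
  have hDe : D * (1 - v) = Real.exp (a * θ) := by rw [hD]; field_simp
  have habs : ∀ r ∈ Icc p q, |r - τ| ≤ θ := fun r hr => by
    rw [abs_le]; constructor <;> linarith [hr.1, hr.2, hτ.1, hτ.2]
  have h1 : ∀ r ∈ Icc p q, ‖d r‖ ≤ ‖d τ‖ * Real.exp (a * θ) + v * ‖d z‖ := fun r hr =>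
    (norm_le_gronwallBound_of_mem_Icc hd hd' hτ le_rfl hr).trans
      (gronwallBound_le ha hb (norm_nonneg _) (norm_nonneg _) (abs_nonneg _) (habs r hr))
  have h2 : ‖d z‖ ≤ D * ‖d τ‖ := by
    have := h1 z hz
    rw [hD, div_mul_eq_mul_div, le_div_iff₀ hv0]
    linarith
  have h3 : ∀ r ∈ Icc p q, ‖d r‖ ≤ D * ‖d τ‖ := fun r hr => by
    have h4 := mul_le_mul_of_nonneg_left h2 hvn
    have h5 := h1 r hr
    rw [← hDe] at h5
    linarith
  have h4 : ‖d s - d τ‖ ≤ (growthRate a b θ * ‖d τ‖) * ‖s - τ‖ := by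
    refine (convex_Icc p q).norm_image_sub_le_of_norm_hasDerivWithin_le hd (fun r hr => ?_) hτ hs
    have := h3 r hr
    calc _ ≤ _ := hd' r hr
      _ ≤ a * (D * ‖d τ‖) + b * (D * ‖d τ‖) := by gcongr
      _ = _ := by rw [growthRate, ← hvdef, ← hD]; ring
  have h5 := norm_le_norm_add_norm_sub' (d s) (d τ)
  have h6 := Real.add_one_le_exp (growthRate a b θ * |s - τ|)
  rw [Real.norm_eq_abs] at h4
  have h7 := mul_le_mul_of_nonneg_right h6 (norm_nonneg (d τ))
  linarith

lemma PiecewiseSolution.norm_sub_le (hB : ConditionB t ζ γ θ) {F : ℤ → ℝ → E → E → E} {a b : ℝ}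
    (hF : LipschitzRHS F a b) (hv : expQuot a θ * b * θ < 1) {u w : ℝ → E}
    (hu : PiecewiseSolution t ζ F u) (hw : PiecewiseSolution t ζ F w) (s τ : ℝ) :
    ‖u s - w s‖ ≤ Real.exp (growthRate a b θ * |s - τ|) * ‖u τ - w τ‖ :=
  hB.le_exp_mul (φ := fun s => ‖u s - w s‖) (fun k _ hs _ hτ =>
    norm_le_exp_growthRate (d := fun s => u s - w s) hF.pos_a hF.pos_b hB.theta_pos hv
      (hB.gap_le k) (hB.zeta_mem k) (fun r hr => (hu k r hr).sub (hw k r hr))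
      (fun r _ => hF.lipschitz k r _ _ _ _) hs hτ) s τ

lemma PiecewiseSolution.eq_of_eq (hB : ConditionB t ζ γ θ) {F : ℤ → ℝ → E → E → E} {a b : ℝ}
    (hF : LipschitzRHS F a b) (hv : expQuot a θ * b * θ < 1) {u w : ℝ → E}
    (hu : PiecewiseSolution t ζ F u) (hw : PiecewiseSolution t ζ F w) {τ : ℝ} (h : u τ = w τ) :
    u = w := by
  ext s
  have := hu.norm_sub_le hB hF hv hw s τ
  rw [h, sub_self, norm_zero, mul_zero, norm_le_zero_iff, sub_eq_zero] at this
  exact this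

/-- On one interval of the partition there is a solution with a prescribed value at a prescribed
time. -/
lemma exists_solution_on_interval [CompleteSpace E] (hB : ConditionB t ζ γ θ)
    {F : ℤ → ℝ → E → E → E} {a b : ℝ}
    (hF : LipschitzRHS F a b) (hv : expQuot a θ * b * θ < 1) (k : ℤ) {τ : ℝ}
    (hτ : τ ∈ Icc (t k) (t (k + 1))) (ξ : E) :
    ∃ y : ℝ → E, y τ = ξ ∧ ∀ s, HasDerivAt y (F k s (y s) (y (ζ k))) s := by
  obtain ⟨C, hC⟩ := hF.bounded
  have hex : ∀ c : E, ∃ y : ℝ → E, y τ = ξ ∧ ∀ s, HasDerivAt y (F k s (y s) c) s := fun c => by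
    refine exists_hasDerivAt_of_lipschitz (F := fun s x => F k s x c) (C := C + b * ‖c‖) hF.pos_a
      (fun x => hF.continuous k x c)
      (fun s x x' => by simpa using hF.lipschitz k s x x' c c) (fun s => ?_) τ ξ
    have h1 := hF.lipschitz k s 0 0 c 0
    have h2 := norm_le_norm_add_norm_sub' (F k s 0 c) (F k s 0 0)
    have h3 := hC k s
    simp only [sub_zero, norm_zero, mul_zero, zero_add] at h1
    linarith
  choose Y hY0 hY using hex
  -- `Y c` solves the equation with the delayed value frozen at `c`. It solves the true equation
  -- exactly when `c` is its own value at `ζ k`, a fixed point problem with contraction factor `v`.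
  have hcontr : ContractingWith (expQuot a θ * b * θ).toNNReal fun c => Y c (ζ k) := by
    refine ⟨by simpa [← NNReal.coe_lt_coe] using hv, LipschitzWith.of_dist_le_mul fun c c' => ?_⟩
    have h1 := norm_le_gronwallBound_of_mem_Icc (y := fun s => Y c s - Y c' s) (a := a)
      (G := b * ‖c - c'‖) (δ := 0)
      (fun s _ => ((hY c s).sub (hY c' s)).hasDerivWithinAt)
      (fun s _ => hF.lipschitz k s _ _ _ _) hτ (by simp [hY0]) (hB.zeta_mem k)
    have h2 := h1.trans (gronwallBound_le hF.pos_a hF.pos_b le_rfl (norm_nonneg _)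
      (abs_nonneg _) (hB.abs_sub_le (hB.zeta_mem k) hτ))
    rw [dist_eq_norm, dist_eq_norm,
      Real.coe_toNNReal _ (expQuot_mul_nonneg hF.pos_a hF.pos_b hB.theta_pos)]
    simpa using h2
  obtain ⟨c, hc⟩ : ∃ c, Y c (ζ k) = c := ⟨_, hcontr.fixedPoint_isFixedPt⟩
  exact ⟨Y c, hY0 c, fun s => by rw [hc]; exact hY c s⟩

/-- Each interval is solvable from either endpoint, so node values can be continued both ways. The
chain is seeded with the left-end value of a local solution through `(τ, ξ)`; uniqueness on that
interval then recovers the value `ξ` at `τ`. -/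
lemma exists_piecewiseSolution [CompleteSpace E] (hB : ConditionB t ζ γ θ)
    {F : ℤ → ℝ → E → E → E} {a b : ℝ}
    (hF : LipschitzRHS F a b) (hv : expQuot a θ * b * θ < 1) (τ : ℝ) (ξ : E) :
    ∃ u : ℝ → E, PiecewiseSolution t ζ F u ∧ u τ = ξ := by
  obtain ⟨k₀, hk₀⟩ := hB.exists_mem_Ico τ
  obtain ⟨y₀, hy₀τ, hy₀⟩ :=
    exists_solution_on_interval hB hF hv k₀ (Ico_subset_Icc_self hk₀) ξ
  obtain ⟨x, hx0, hx⟩ := exists_int_chain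
    (R := fun k x x' => ∃ y : ℝ → E, (∀ s, HasDerivAt y (F k s (y s) (y (ζ k))) s) ∧
      y (t k) = x ∧ y (t (k + 1)) = x')
    (fun k x => by
      obtain ⟨y, h1, h2⟩ := exists_solution_on_interval hB hF hv k (hB.mem_left k) x
      exact ⟨_, y, h2, h1, rfl⟩)
    (fun k x => by
      obtain ⟨y, h1, h2⟩ := exists_solution_on_interval hB hF hv k (hB.mem_right k) x
      exact ⟨_, y, h2, rfl, h1⟩) k₀ (y₀ (t k₀))
  choose y hy hyl hyr using hx
  obtain ⟨u, hu⟩ := hB.exists_glue y fun k => by rw [hyr, hyl]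
  refine ⟨u, fun k s hs => ?_, ?_⟩
  · rw [hu k (hB.zeta_mem k), hu k hs]
    exact (hy k s).hasDerivWithinAt.congr (hu k) (hu k hs)
  · have hτ := Ico_subset_Icc_self hk₀
    have h1 := norm_le_exp_growthRate (d := fun s => y k₀ s - y₀ s) hF.pos_a hF.pos_b
      hB.theta_pos hv (hB.gap_le k₀) (hB.zeta_mem k₀)
      (fun r _ => ((hy k₀ r).sub (hy₀ r)).hasDerivWithinAt)
      (fun r _ => hF.lipschitz k₀ r _ _ _ _) hτ (hB.mem_left k₀)
    rw [hyl, hx0, sub_self, norm_zero, mul_zero, norm_le_zero_iff, sub_eq_zero] at h1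
    rw [hu k₀ hτ, h1, hy₀τ]

end Piecewise

/-! ### The linear system and its transition operators. -/

section Transition

variable {E : Type*} [NormedAddCommGroup E] [NormedSpace ℝ E] {t ζ : ℤ → ℝ} {γ : ℝ → ℝ} {θ : ℝ}
  {A A₀ : ℝ → E →L[ℝ] E} {M M₀ : ℝ}

/-- Right-hand side of a linear system with an inhomogeneity that depends on the interval. -/
def inhomogeneousRHS (A A₀ : ℝ → E →L[ℝ] E) (g : ℤ → ℝ → E) : ℤ → ℝ → E → E → E :=
  fun k s x y => linearRHS A A₀ s x y + g k s

/-- The coefficients are continuous and bounded, and one interval of the partition is short enough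
for the linear system to be solvable in both directions. -/
structure AdmissibleCoeff (t ζ : ℤ → ℝ) (γ : ℝ → ℝ) (A A₀ : ℝ → E →L[ℝ] E) (M M₀ θ : ℝ) :
    Prop where
  condB : ConditionB t ζ γ θ
  continuous_A : Continuous A
  continuous_A₀ : Continuous A₀
  M_pos : 0 < M
  M₀_pos : 0 < M₀
  norm_A_le : ∀ s, ‖A s‖ ≤ M
  norm_A₀_le : ∀ s, ‖A₀ s‖ ≤ M₀
  vTilde_lt_one : expQuot M θ * M₀ * θ < 1

lemma AdmissibleCoeff.lipschitz_inhomogeneous (hA : AdmissibleCoeff t ζ γ A A₀ M M₀ θ)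
    {g : ℤ → ℝ → E} (hg : ∀ k, Continuous (g k)) {C : ℝ} (hC : ∀ k s, ‖g k s‖ ≤ C) :
    LipschitzRHS (inhomogeneousRHS A A₀ g) M M₀ where
  pos_a := hA.M_pos
  pos_b := hA.M₀_pos
  continuous k x y := by
    have := hA.continuous_A
    have := hA.continuous_A₀
    have := hg k
    unfold inhomogeneousRHS linearRHS
    fun_prop
  lipschitz k s x x' y y' := by
    have h : inhomogeneousRHS A A₀ g k s x y - inhomogeneousRHS A A₀ g k s x' y'
        = A s (x - x') + A₀ s (y - y') := by
      simp only [inhomogeneousRHS, linearRHS, map_sub]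
      abel
    rw [h]
    exact (norm_add_le _ _).trans (add_le_add ((A s).le_of_opNorm_le (hA.norm_A_le s) _)
      ((A₀ s).le_of_opNorm_le (hA.norm_A₀_le s) _))
  bounded := ⟨C, fun k s => by simpa [inhomogeneousRHS, linearRHS] using hC k s⟩

lemma inhomogeneousRHS_zero :
    inhomogeneousRHS A A₀ (fun _ _ => 0) = fun _ => linearRHS A A₀ := by
  funext k s x y
  simp [inhomogeneousRHS]

lemma AdmissibleCoeff.lipschitz_linear (hA : AdmissibleCoeff t ζ γ A A₀ M M₀ θ) :
    LipschitzRHS (fun _ : ℤ => linearRHS A A₀) M M₀ := by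
  rw [← inhomogeneousRHS_zero]
  exact hA.lipschitz_inhomogeneous (fun _ => continuous_const) (C := 0) (by simp)

lemma PiecewiseSolution.sub {g g' : ℤ → ℝ → E} {u u' : ℝ → E}
    (hu : PiecewiseSolution t ζ (inhomogeneousRHS A A₀ g) u)
    (hu' : PiecewiseSolution t ζ (inhomogeneousRHS A A₀ g') u') :
    PiecewiseSolution t ζ (inhomogeneousRHS A A₀ fun k s => g k s - g' k s)
      fun s => u s - u' s := fun k s hs => by
  refine ((hu k s hs).sub (hu' k s hs)).congr_deriv ?_
  simp only [inhomogeneousRHS, linearRHS, map_sub]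
  abel

lemma PiecewiseSolution.add_linear {u u' : ℝ → E}
    (hu : PiecewiseSolution t ζ (fun _ => linearRHS A A₀) u)
    (hu' : PiecewiseSolution t ζ (fun _ => linearRHS A A₀) u') :
    PiecewiseSolution t ζ (fun _ => linearRHS A A₀) fun s => u s + u' s := fun k s hs => by
  refine ((hu k s hs).add (hu' k s hs)).congr_deriv ?_
  simp only [linearRHS, map_add]
  abel

lemma PiecewiseSolution.smul_linear {u : ℝ → E}
    (hu : PiecewiseSolution t ζ (fun _ => linearRHS A A₀) u) (c : ℝ) :
    PiecewiseSolution t ζ (fun _ => linearRHS A A₀) fun s => c • u s := fun k s hs => by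
  refine ((hu k s hs).const_smul c).congr_deriv ?_
  simp only [linearRHS, map_smul, smul_add]

variable [FiniteDimensional ℝ E]

/-- Superposition and uniqueness make the value at `s` linear in the value at `τ`. This puts
`transition` in the meaningful branch of its definition. -/
lemma AdmissibleCoeff.existsUnique_transition (hA : AdmissibleCoeff t ζ γ A A₀ M M₀ θ)
    (s τ : ℝ) :
    ∃! T : E →L[ℝ] E, ∀ z : ℝ → E, IsSolution t γ (linearRHS A A₀) z → z s = T (z τ) := by
  have := FiniteDimensional.complete ℝ E
  have hF := hA.lipschitz_linear
  have hv := hA.vTilde_lt_one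
  have hB := hA.condB
  choose u hu hu0 using fun ξ => exists_piecewiseSolution hB hF hv τ ξ
  have huniq : ∀ {w : ℝ → E}, PiecewiseSolution t ζ (fun _ => linearRHS A A₀) w →
      w = u (w τ) := fun hw => hw.eq_of_eq hB hF hv (hu _) (hu0 _).symm
  let T : E →ₗ[ℝ] E :=
    { toFun := fun ξ => u ξ s
      map_add' := fun x y => by
        have := huniq ((hu x).add_linear (hu y))
        simp only [hu0] at this
        exact (congrFun this s).symm
      map_smul' := fun c x => by
        have := huniq ((hu x).smul_linear c)
        simp only [hu0] at this
        exact (congrFun this s).symm }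
  refine ⟨LinearMap.toContinuousLinearMap T, fun z hz => ?_, fun T' hT' => ?_⟩
  · exact congrFun (huniq ((isSolution_iff_piecewise hB hF).1 hz)) s
  · ext ξ
    have := hT' (u ξ) ((isSolution_iff_piecewise hB hF).2 (hu ξ))
    rw [hu0] at this
    exact this.symm

lemma AdmissibleCoeff.transition_apply (hA : AdmissibleCoeff t ζ γ A A₀ M M₀ θ) {z : ℝ → E}
    (hz : PiecewiseSolution t ζ (fun _ => linearRHS A A₀) z) (s τ : ℝ) :
    transition t γ A A₀ s τ (z τ) = z s := by
  have h := hA.existsUnique_transition s τ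
  rw [transition, dif_pos h]
  exact (h.choose_spec.1 z ((isSolution_iff_piecewise hA.condB hA.lipschitz_linear).2 hz)).symm

lemma AdmissibleCoeff.piecewiseSolution_transition (hA : AdmissibleCoeff t ζ γ A A₀ M M₀ θ)
    (τ : ℝ) (ξ : E) :
    PiecewiseSolution t ζ (fun _ => linearRHS A A₀) fun s => transition t γ A A₀ s τ ξ := by
  have := FiniteDimensional.complete ℝ E
  obtain ⟨u, hu, rfl⟩ := exists_piecewiseSolution hA.condB hA.lipschitz_linear hA.vTilde_lt_one τ ξ
  simpa only [hA.transition_apply hu] using hu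

lemma AdmissibleCoeff.transition_self (hA : AdmissibleCoeff t ζ γ A A₀ M M₀ θ) (τ : ℝ) (ξ : E) :
    transition t γ A A₀ τ τ ξ = ξ := by
  have := FiniteDimensional.complete ℝ E
  obtain ⟨u, hu, rfl⟩ := exists_piecewiseSolution hA.condB hA.lipschitz_linear hA.vTilde_lt_one τ ξ
  exact hA.transition_apply hu τ τ

lemma AdmissibleCoeff.transition_comp (hA : AdmissibleCoeff t ζ γ A A₀ M M₀ θ) (s r τ : ℝ)
    (ξ : E) :
    transition t γ A A₀ s r (transition t γ A A₀ r τ ξ) = transition t γ A A₀ s τ ξ :=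
  hA.transition_apply (hA.piecewiseSolution_transition τ ξ) s r

end Transition

/-! ### Scalar inequalities behind the constant `2e^{βθ}/β`. -/

section ScalarEstimates

/-- At `y = x` this follows from `e^x ≥ 1 + x + x²/2` and `e^{-x} ≥ 1 - x`; concavity of `1 -
e^{-y}` gives it below. The saving `x/2` later pays for the current interval. -/
lemma le_mul_one_sub_exp_neg {x y : ℝ} (hy : 0 ≤ y) (hyx : y ≤ x) :
    y ≤ (Real.exp x - x / 2) * (1 - Real.exp (-y)) := by
  rcases (hy.trans hyx).eq_or_lt with h0 | hx
  · have : y = 0 := by linarith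
    simp [this]
  have hxe : x ≤ (Real.exp x - x / 2) * (1 - Real.exp (-x)) := by
    have h1 : Real.exp x * Real.exp (-x) = 1 := by rw [← Real.exp_add]; simp
    have h2 := Real.quadratic_le_exp_of_nonneg hx.le
    have h3 := Real.add_one_le_exp (-x)
    nlinarith
  have hc : 0 ≤ Real.exp x - x / 2 := by
    have := Real.add_one_le_exp x
    linarith
  have hchord : y / x * (1 - Real.exp (-x)) ≤ 1 - Real.exp (-y) := by
    have hw : y / x ≤ 1 := (div_le_one hx).2 hyx
    have hw0 : 0 ≤ y / x := by positivity
    have := convexOn_exp.2 (mem_univ (-x)) (mem_univ 0) hw0 (sub_nonneg.2 hw) (by ring)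
    have e : y / x * -x + (1 - y / x) * 0 = -y := by field_simp; ring
    simp only [smul_eq_mul, e, Real.exp_zero] at this
    linarith
  calc y = y / x * x := by field_simp
    _ ≤ y / x * ((Real.exp x - x / 2) * (1 - Real.exp (-x))) := by gcongr
    _ = (Real.exp x - x / 2) * (y / x * (1 - Real.exp (-x))) := by ring
    _ ≤ _ := by gcongr

/-- Replacing `x/2` by `(P + Q)/2` leaves `P + (P + Q)(e^{-Q} - e^{-P})/2` to be covered by `e^x(1 -
e^{-P}) + e^x(1 - e^{-Q})`. The latter is at least `P + P²/2 + Q`, and the quadratic term is needed.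
-/
lemma interval_cost_le {x P Q : ℝ} (hP : 0 ≤ P) (hQ : 0 ≤ Q) (hx : P + Q ≤ x) :
    (Real.exp x - x / 2) * (Real.exp (-P) + Real.exp (-Q)) + ((P + Q) * Real.exp (-Q) + P)
      ≤ 2 * Real.exp x := by
  have hPe : Real.exp P * Real.exp (-P) = 1 := by rw [← Real.exp_add]; simp
  have hQe : Real.exp Q * Real.exp (-Q) = 1 := by rw [← Real.exp_add]; simp
  have hP1 : Real.exp (-P) ≤ 1 := Real.exp_le_one_iff.2 (by linarith)
  have hQ1 : Real.exp (-Q) ≤ 1 := Real.exp_le_one_iff.2 (by linarith)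
  have hP2 := Real.add_one_le_exp (-P)
  have hP3 := Real.quadratic_le_exp_of_nonneg hP
  have hQ3 := Real.add_one_le_exp Q
  have hQ4 : 1 ≤ Real.exp Q := Real.one_le_exp hQ
  have hP4 : 1 ≤ Real.exp P := Real.one_le_exp hP
  have hxx : Real.exp P * Real.exp Q ≤ Real.exp x := by
    rw [← Real.exp_add]; exact Real.exp_le_exp.2 hx
  have h1 : P + P ^ 2 / 2 ≤ Real.exp x * (1 - Real.exp (-P)) := by
    calc P + P ^ 2 / 2 ≤ Real.exp P - 1 := by linarith
      _ ≤ Real.exp Q * (Real.exp P - 1) := le_mul_of_one_le_left (by linarith) hQ4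
      _ = Real.exp P * Real.exp Q * (1 - Real.exp (-P)) := by linear_combination Real.exp Q * hPe
      _ ≤ _ := by gcongr
  have h2 : Q ≤ Real.exp x * (1 - Real.exp (-Q)) := by
    calc Q ≤ Real.exp Q - 1 := by linarith
      _ ≤ Real.exp P * (Real.exp Q - 1) := le_mul_of_one_le_left (by linarith) hP4
      _ = Real.exp P * Real.exp Q * (1 - Real.exp (-Q)) := by linear_combination Real.exp P * hQe
      _ ≤ _ := by gcongr
  have h3 : (P + Q) / 2 * (Real.exp (-P) + Real.exp (-Q)) ≤
      x / 2 * (Real.exp (-P) + Real.exp (-Q)) := by gcongr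
  have h4 : (P + Q) * (Real.exp (-Q) - Real.exp (-P)) ≤ P ^ 2 + Q := by
    have h5 : Real.exp (-Q) - Real.exp (-P) ≤ P := by linarith
    have h6 : Real.exp (-Q) - Real.exp (-P) ≤ 1 := by linarith [Real.exp_pos (-P)]
    nlinarith
  nlinarith

/-- The contributions of the past, of the future and of the current interval `[-p, q]`, in which
the switching point has distance `z` from the left endpoint, to the bound at time `0`. -/
lemma switching_cost_le {β θ p q z : ℝ} (hβ : 0 < β) (hp : 0 ≤ p) (hq : 0 ≤ q) (hpq : p + q ≤ θ)
    (hz : 0 ≤ z) (hzpq : z ≤ p + q) :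
    (Real.exp (β * θ) - β * θ / 2) / β * (Real.exp (-(β * p)) + Real.exp (-(β * q))) +
      (z * Real.exp (-(β * p)) + (p + q - z) * Real.exp (-(β * q)) + |z - p|)
      ≤ 2 * Real.exp (β * θ) / β := by
  have hx : β * p + β * q ≤ β * θ := by nlinarith
  have h1 := interval_cost_le (x := β * θ) (P := β * p) (Q := β * q) (by positivity)
    (by positivity) hx
  have h2 := interval_cost_le (x := β * θ) (P := β * q) (Q := β * p) (by positivity)
    (by positivity) (by linarith)
  set a := Real.exp (-(β * p))
  set b := Real.exp (-(β * q))
  set c := Real.exp (β * θ)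
  have ha1 : a ≤ 1 := Real.exp_le_one_iff.2 (by nlinarith)
  have hb1 : b ≤ 1 := Real.exp_le_one_iff.2 (by nlinarith)
  have ha0 : 0 < a := Real.exp_pos _
  have hb0 : 0 < b := Real.exp_pos _
  -- The cost is convex in `z`, so the worst switching points are the two endpoints; these cases are
  -- mirror images, covered by `h1` and `h2`.
  have h3 : β * (z * a + (p + q - z) * b + |z - p|) ≤
      max ((β * p + β * q) * b + β * p) ((β * q + β * p) * a + β * q) := by
    rcases le_total z p with h | h
    · rw [abs_of_nonpos (by linarith)]
      refine le_max_of_le_left ?_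
      have : 0 ≤ β * z * (1 + b - a) := mul_nonneg (by positivity) (by linarith)
      nlinarith
    · rw [abs_of_nonneg (by linarith)]
      refine le_max_of_le_right ?_
      have : 0 ≤ β * (p + q - z) * (1 + a - b) :=
        mul_nonneg (mul_nonneg hβ.le (by linarith)) (by linarith)
      nlinarith
  rw [le_div_iff₀ hβ, add_mul, mul_right_comm, div_mul_cancel₀ _ hβ.ne']
  rcases le_max_iff.1 h3 with h | h <;> linarith

end ScalarEstimates

/-! ### Dichotomy bounds for the increments over single intervals. -/

section LinearEstimate

variable {E : Type*} [NormedAddCommGroup E] [NormedSpace ℝ E] {t ζ : ℤ → ℝ} {γ : ℝ → ℝ} {θ : ℝ}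
  {A A₀ : ℝ → E →L[ℝ] E} {M M₀ K α : ℝ} {P : E →L[ℝ] E}

/-- An admissible linear system together with an exponential dichotomy with projection `P`. -/
structure DichotomousSystem (t ζ : ℤ → ℝ) (γ : ℝ → ℝ) (A A₀ : ℝ → E →L[ℝ] E)
    (M M₀ θ K α : ℝ) (P : E →L[ℝ] E) : Prop extends AdmissibleCoeff t ζ γ A A₀ M M₀ θ where
  one_le_K : 1 ≤ K
  α_pos : 0 < α
  proj : ∀ x, P (P x) = P x
  norm_kernel_le : ∀ s τ,
    ‖dichotomyKernel t γ A A₀ P s τ‖ ≤ K * Real.exp (-α * |s - τ|)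

/-- Solutions of the ordinary differential equations `b k' = A b k + g k` with `b k (ζ k) = 0`. -/
structure LocalParticular (ζ : ℤ → ℝ) (A : ℝ → E →L[ℝ] E) (g b : ℤ → ℝ → E) : Prop where
  zero : ∀ k, b k (ζ k) = 0
  hasDerivAt : ∀ k s, HasDerivAt (b k) (A s (b k s) + g k s) s

/-- Change over the `k`-th interval, pulled back to time `0`, of a solution of the inhomogeneous
system with local particular solutions `b`. -/
noncomputable def increment (t : ℤ → ℝ) (γ : ℝ → ℝ) (A A₀ : ℝ → E →L[ℝ] E) (b : ℤ → ℝ → E)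
    (k : ℤ) : E :=
  transition t γ A A₀ 0 (t (k + 1)) (b k (t (k + 1))) - transition t γ A A₀ 0 (t k) (b k (t k))

lemma AdmissibleCoeff.exists_localParticular [CompleteSpace E]
    (hA : AdmissibleCoeff t ζ γ A A₀ M M₀ θ)
    {g : ℤ → ℝ → E} (hg : ∀ k, Continuous (g k)) {C : ℝ} (hC : ∀ k s, ‖g k s‖ ≤ C) :
    ∃ b, LocalParticular ζ A g b := by
  have h : ∀ k, ∃ y : ℝ → E, y (ζ k) = 0 ∧ ∀ s, HasDerivAt y (A s (y s) + g k s) s := fun k =>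
    exists_hasDerivAt_of_lipschitz (F := fun s x => A s x + g k s) hA.M_pos
      (fun x => by have := hA.continuous_A; have := hg k; fun_prop)
      (fun s x x' => by
        rw [add_sub_add_right_eq_sub, ← map_sub]
        exact (A s).le_of_opNorm_le (hA.norm_A_le s) _)
      (fun s => by simpa using hC k s) _ _
  choose b hb0 hb using h
  exact ⟨b, hb0, hb⟩

/-- The bound `e^{Mθ}` makes the family bounded above, so that the real supremum defining `rho`
dominates each of its members. -/
lemma AdmissibleCoeff.exp_integral_le_rho (hA : AdmissibleCoeff t ζ γ A A₀ M M₀ θ) (k : ℤ) :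
    Real.exp (∫ s in (t k)..(t (k + 1)), ‖A s‖) ≤ rho t ζ A := by
  have hint : ∀ p q, IntervalIntegrable (fun s => ‖A s‖) MeasureTheory.volume p q := fun p q =>
    hA.continuous_A.norm.intervalIntegrable p q
  have heq : ∀ k, rhoPlus t ζ A k * rhoMinus t ζ A k
      = Real.exp (∫ s in (t k)..(t (k + 1)), ‖A s‖) := fun k => by
    rw [rhoPlus, rhoMinus, ← Real.exp_add,
      intervalIntegral.integral_add_adjacent_intervals (hint _ _) (hint _ _)]
  have hbdd : BddAbove (range fun k => rhoPlus t ζ A k * rhoMinus t ζ A k) := by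
    refine ⟨Real.exp (M * θ), ?_⟩
    rintro _ ⟨k, rfl⟩
    simp only [heq]
    refine Real.exp_le_exp.2 ?_
    have hle := (hA.condB.lt_succ k).le
    calc ∫ s in (t k)..(t (k + 1)), ‖A s‖ ≤ ∫ s in (t k)..(t (k + 1)), M :=
          intervalIntegral.integral_mono_on hle (hint _ _) (by simp) fun s _ => hA.norm_A_le s
      _ = M * (t (k + 1) - t k) := by simp [mul_comm]
      _ ≤ M * θ := by have := hA.M_pos; have := hA.condB.gap_le k; gcongr
  rw [← heq]
  exact le_ciSup hbdd k

lemma LocalParticular.norm_le (hA : AdmissibleCoeff t ζ γ A A₀ M M₀ θ) {g b : ℤ → ℝ → E}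
    (hb : LocalParticular ζ A g b) {k : ℤ} {G : ℝ}
    (hG : ∀ s ∈ Icc (t k) (t (k + 1)), ‖g k s‖ ≤ G) {s : ℝ} (hs : s ∈ Icc (t k) (t (k + 1))) :
    ‖b k s‖ ≤ G * rho t ζ A * |s - ζ k| := by
  have hG0 : 0 ≤ G := (norm_nonneg _).trans (hG s hs)
  have h1 := norm_le_mul_exp_integral (a := fun s => ‖A s‖) (G := G) hA.continuous_A.norm
    (fun _ => norm_nonneg _) (fun r _ => (hb.hasDerivAt k r).hasDerivWithinAt)
    (fun r hr => (norm_add_le _ _).trans (add_le_add ((A r).le_opNorm _) (hG r hr)))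
    (hA.condB.zeta_mem k) (hb.zero k) hs
  refine h1.trans ?_
  rw [mul_right_comm]
  gcongr
  exact hA.exp_integral_le_rho k

/-- The distances from `ζ k` to the two endpoints add up to the length of the interval, so the total
does not depend on the switching point. -/
lemma LocalParticular.norm_add_norm_le (hA : AdmissibleCoeff t ζ γ A A₀ M M₀ θ)
    {g b : ℤ → ℝ → E} (hb : LocalParticular ζ A g b) {k : ℤ} {G : ℝ}
    (hG : ∀ s ∈ Icc (t k) (t (k + 1)), ‖g k s‖ ≤ G) :
    ‖b k (t (k + 1))‖ + ‖b k (t k)‖ ≤ G * rho t ζ A * (t (k + 1) - t k) := by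
  have h1 := hb.norm_le hA hG (hA.condB.mem_left k)
  have h2 := hb.norm_le hA hG (hA.condB.mem_right k)
  have hz := hA.condB.zeta_mem k
  rw [abs_of_nonpos (by linarith [hz.1])] at h1
  rw [abs_of_nonneg (by linarith [hz.2])] at h2
  linarith

lemma norm_le_of_telescope {X : Type*} [NormedAddCommGroup X] {a : ℕ → X} {S : ℕ → ℝ}
    (ha : Tendsto a atTop (𝓝 0)) (hS : ∀ n, 0 ≤ S n)
    (h : ∀ n, ‖a n - a (n + 1)‖ ≤ S n - S (n + 1)) : ‖a 0‖ ≤ S 0 := by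
  have key : ∀ n, ‖a 0‖ ≤ ‖a n‖ + S 0 := fun n => by
    have : ‖a 0‖ ≤ ‖a n‖ + (S 0 - S n) := by
      induction n with
      | zero => simp
      | succ n ih =>
        have h1 := norm_le_norm_add_norm_sub' (a n) (a (n + 1))
        have h2 := h n
        linarith
    linarith [hS n]
  have hlim : Tendsto (fun n => ‖a n‖ + S 0) atTop (𝓝 (‖(0 : X)‖ + S 0)) :=
    ha.norm.add tendsto_const_nhds
  have := ge_of_tendsto' hlim key
  simpa using this

lemma summable_of_telescope {X : Type*} [NormedAddCommGroup X] [CompleteSpace X]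
    {c : ℕ → X} {S : ℕ → ℝ} (hS : ∀ n, 0 ≤ S n)
    (h : ∀ n, ‖c n‖ ≤ S n - S (n + 1)) : Summable c := by
  refine Summable.of_norm (summable_of_sum_range_le (c := S 0) (fun n => norm_nonneg _) fun n => ?_)
  calc ∑ i ∈ Finset.range n, ‖c i‖ ≤ ∑ i ∈ Finset.range n, (S i - S (i + 1)) :=
        Finset.sum_le_sum fun i _ => h i
    _ = S 0 - S n := Finset.sum_range_sub' _ _
    _ ≤ S 0 := by linarith [hS n]

namespace DichotomousSystem

lemma norm_stable_le (hD : DichotomousSystem t ζ γ A A₀ M M₀ θ K α P) {s τ : ℝ} (h : τ ≤ s)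
    (x : E) :
    ‖transition t γ A A₀ s 0 (P (transition t γ A A₀ 0 τ x))‖
      ≤ K * Real.exp (-(α * (s - τ))) * ‖x‖ := by
  have h1 := (dichotomyKernel t γ A A₀ P s τ).le_of_opNorm_le (hD.norm_kernel_le s τ) x
  rw [dichotomyKernel, if_pos h, abs_of_nonneg (sub_nonneg.2 h), neg_mul] at h1
  exact h1

lemma norm_unstable_le (hD : DichotomousSystem t ζ γ A A₀ M M₀ θ K α P) {s τ : ℝ} (h : s < τ)
    (x : E) :
    ‖transition t γ A A₀ s 0 ((ContinuousLinearMap.id ℝ E - P) (transition t γ A A₀ 0 τ x))‖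
      ≤ K * Real.exp (-(α * (τ - s))) * ‖x‖ := by
  have h1 := (dichotomyKernel t γ A A₀ P s τ).le_of_opNorm_le (hD.norm_kernel_le s τ) x
  rw [dichotomyKernel, if_neg (not_le.2 h), abs_sub_comm, abs_of_nonneg (sub_nonneg.2 h.le),
    neg_mul, neg_apply, norm_neg] at h1
  exact h1

lemma rho_pos (hD : DichotomousSystem t ζ γ A A₀ M M₀ θ K α P) : 0 < rho t ζ A :=
  (Real.exp_pos _).trans_le (hD.exp_integral_le_rho 0)

end DichotomousSystem

/-- The constant that multiplies the distances in the estimates at time `s`. -/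
noncomputable def estimateConst (t ζ : ℤ → ℝ) (A : ℝ → E →L[ℝ] E) (θ K G η t₀ s : ℝ) : ℝ :=
  K * rho t ζ A * G * Real.exp (η * θ) * Real.exp (η * |s - t₀|)

/-- The constant in the telescoping bound for the sums over the intervals. -/
noncomputable def telescopeConst (β θ : ℝ) : ℝ := (Real.exp (β * θ) - β * θ / 2) / β

lemma telescopeConst_nonneg {β θ : ℝ} (hβ : 0 < β) (hθ : 0 < θ) : 0 ≤ telescopeConst β θ := by
  have := Real.add_one_le_exp (β * θ)
  have : 0 ≤ Real.exp (β * θ) - β * θ / 2 := by nlinarith [mul_pos hβ hθ]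
  unfold telescopeConst
  positivity

/-- A sum of length times exponential is a Riemann sum for `∫ e^{-βr} dr`; bounding each term by a
difference of exponentials makes it telescope on any mesh of size at most `θ`. -/
lemma mul_exp_le_telescope {β θ l d : ℝ} (hβ : 0 < β) (hl : 0 ≤ l) (hlθ : l ≤ θ) :
    l * Real.exp (-(β * d)) ≤
      telescopeConst β θ * (Real.exp (-(β * d)) - Real.exp (-(β * (d + l)))) := by
  have h := le_mul_one_sub_exp_neg (x := β * θ) (y := β * l) (by positivity) (by gcongr)
  have e : Real.exp (-(β * (d + l))) = Real.exp (-(β * d)) * Real.exp (-(β * l)) := by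
    rw [← Real.exp_add]; ring_nf
  have h2 : l ≤ telescopeConst β θ * (1 - Real.exp (-(β * l))) := by
    rw [telescopeConst, div_mul_eq_mul_div, le_div_iff₀ hβ]
    linarith
  rw [e]
  have := mul_le_mul_of_nonneg_right h2 (Real.exp_pos (-(β * d))).le
  linarith

namespace DichotomousSystem

lemma estimateConst_nonneg (hD : DichotomousSystem t ζ γ A A₀ M M₀ θ K α P) {G : ℝ} (hG : 0 ≤ G)
    (η t₀ s : ℝ) : 0 ≤ estimateConst t ζ A θ K G η t₀ s := by
  have := hD.rho_pos
  have := hD.one_le_K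
  unfold estimateConst
  positivity

/-- The inhomogeneity may grow at rate `η` away from `t₀` while the stable part decays at rate `α`;
the net rate `α - η` enters the telescoping. The shift from the endpoint to the whole interval costs
the factor `e^{ηθ}`. -/
lemma norm_stable_increment_le (hD : DichotomousSystem t ζ γ A A₀ M M₀ θ K α P)
    {g b : ℤ → ℝ → E} (hb : LocalParticular ζ A g b) {G η t₀ : ℝ} (hη : 0 ≤ η) (hηα : η < α)
    (hG0 : 0 ≤ G)
    (hG : ∀ k, ∀ s ∈ Icc (t k) (t (k + 1)), ‖g k s‖ ≤ G * Real.exp (η * |s - t₀|))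
    {s : ℝ} {k : ℤ} (hk : t (k + 1) ≤ s) :
    ‖transition t γ A A₀ s 0 (P (increment t γ A A₀ b k))‖ ≤
      estimateConst t ζ A θ K G η t₀ s * telescopeConst (α - η) θ *
        (Real.exp (-((α - η) * (s - t (k + 1)))) - Real.exp (-((α - η) * (s - t k)))) := by
  have hB := hD.condB
  have hK := hD.one_le_K
  have hα := hD.α_pos
  have hgap := hB.gap_le k
  have hlt := hB.lt_succ k
  have hsum := hb.norm_add_norm_le hD.toAdmissibleCoeff (k := k)
    (G := G * Real.exp (η * (|s - t₀| + (s - t (k + 1)) + θ))) fun r hr => by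
      refine (hG k r hr).trans ?_
      gcongr
      have h1 : |r - t₀| ≤ |r - s| + |s - t₀| := abs_sub_le _ _ _
      rw [abs_sub_comm r s, abs_of_nonneg (a := s - r) (by linarith [hr.2])] at h1
      linarith [hr.1]
  have h1 := hD.norm_stable_le hk (b k (t (k + 1)))
  have h2 := hD.norm_stable_le (hlt.le.trans hk) (b k (t k))
  have h3 : Real.exp (-(α * (s - t k))) ≤ Real.exp (-(α * (s - t (k + 1)))) :=
    Real.exp_le_exp.2 (by nlinarith)
  have h4 : K * Real.exp (-(α * (s - t k))) * ‖b k (t k)‖ ≤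
      K * Real.exp (-(α * (s - t (k + 1)))) * ‖b k (t k)‖ := by gcongr
  rw [increment, map_sub, map_sub]
  have htel := mul_exp_le_telescope (β := α - η) (θ := θ) (l := t (k + 1) - t k)
    (d := s - t (k + 1)) (by linarith) (by linarith) hgap
  rw [show s - t (k + 1) + (t (k + 1) - t k) = s - t k by ring] at htel
  calc _ ≤ _ := norm_sub_le _ _
    _ ≤ K * Real.exp (-(α * (s - t (k + 1)))) * (‖b k (t (k + 1))‖ + ‖b k (t k)‖) := by linarith
    _ ≤ K * Real.exp (-(α * (s - t (k + 1)))) *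
        (G * Real.exp (η * (|s - t₀| + (s - t (k + 1)) + θ)) * rho t ζ A * (t (k + 1) - t k)) := by
        gcongr
    _ = estimateConst t ζ A θ K G η t₀ s *
        ((t (k + 1) - t k) * Real.exp (-((α - η) * (s - t (k + 1))))) := by
        rw [estimateConst, show -((α - η) * (s - t (k + 1)))
          = -(α * (s - t (k + 1))) + η * (s - t (k + 1)) by ring, Real.exp_add, mul_add, mul_add,
          Real.exp_add, Real.exp_add]
        ring
    _ ≤ _ := by
        rw [mul_assoc]
        exact mul_le_mul_of_nonneg_left htel (hD.estimateConst_nonneg hG0 _ _ _)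

lemma norm_unstable_increment_le (hD : DichotomousSystem t ζ γ A A₀ M M₀ θ K α P)
    {g b : ℤ → ℝ → E} (hb : LocalParticular ζ A g b) {G η t₀ : ℝ} (hη : 0 ≤ η) (hηα : η < α)
    (hG0 : 0 ≤ G)
    (hG : ∀ k, ∀ s ∈ Icc (t k) (t (k + 1)), ‖g k s‖ ≤ G * Real.exp (η * |s - t₀|))
    {s : ℝ} {k : ℤ} (hk : s < t k) :
    ‖transition t γ A A₀ s 0 ((ContinuousLinearMap.id ℝ E - P) (increment t γ A A₀ b k))‖ ≤
      estimateConst t ζ A θ K G η t₀ s * telescopeConst (α - η) θ *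
        (Real.exp (-((α - η) * (t k - s))) - Real.exp (-((α - η) * (t (k + 1) - s)))) := by
  have hB := hD.condB
  have hK := hD.one_le_K
  have hα := hD.α_pos
  have hgap := hB.gap_le k
  have hlt := hB.lt_succ k
  have hsum := hb.norm_add_norm_le hD.toAdmissibleCoeff (k := k)
    (G := G * Real.exp (η * (|s - t₀| + (t k - s) + θ))) fun r hr => by
      refine (hG k r hr).trans ?_
      gcongr
      have h1 : |r - t₀| ≤ |r - s| + |s - t₀| := abs_sub_le _ _ _
      rw [abs_of_nonneg (a := r - s) (by linarith [hr.1])] at h1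
      linarith [hr.2]
  have h1 := hD.norm_unstable_le (hk.trans hlt) (b k (t (k + 1)))
  have h2 := hD.norm_unstable_le hk (b k (t k))
  have h3 : Real.exp (-(α * (t (k + 1) - s))) ≤ Real.exp (-(α * (t k - s))) :=
    Real.exp_le_exp.2 (by nlinarith)
  have h4 : K * Real.exp (-(α * (t (k + 1) - s))) * ‖b k (t (k + 1))‖ ≤
      K * Real.exp (-(α * (t k - s))) * ‖b k (t (k + 1))‖ := by gcongr
  rw [increment, map_sub, map_sub]
  have htel := mul_exp_le_telescope (β := α - η) (θ := θ) (l := t (k + 1) - t k)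
    (d := t k - s) (by linarith) (by linarith) hgap
  rw [show t k - s + (t (k + 1) - t k) = t (k + 1) - s by ring] at htel
  calc _ ≤ _ := norm_sub_le _ _
    _ ≤ K * Real.exp (-(α * (t k - s))) * (‖b k (t (k + 1))‖ + ‖b k (t k)‖) := by linarith
    _ ≤ K * Real.exp (-(α * (t k - s))) *
        (G * Real.exp (η * (|s - t₀| + (t k - s) + θ)) * rho t ζ A * (t (k + 1) - t k)) := by
        gcongr
    _ = estimateConst t ζ A θ K G η t₀ s *
        ((t (k + 1) - t k) * Real.exp (-((α - η) * (t k - s)))) := by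
        rw [estimateConst, show -((α - η) * (t k - s))
          = -(α * (t k - s)) + η * (t k - s) by ring, Real.exp_add, mul_add, mul_add,
          Real.exp_add, Real.exp_add]
        ring
    _ ≤ _ := by
        rw [mul_assoc]
        exact mul_le_mul_of_nonneg_left htel (hD.estimateConst_nonneg hG0 _ _ _)

end DichotomousSystem

end LinearEstimate

/-! ### Existence and weighted bounds for the inhomogeneous linear system. -/

section BoundedSolutions

variable {E : Type*} [NormedAddCommGroup E] [NormedSpace ℝ E] {t ζ : ℤ → ℝ} {γ : ℝ → ℝ} {θ : ℝ}
  {A A₀ : ℝ → E →L[ℝ] E} {M M₀ K α : ℝ} {P : E →L[ℝ] E} [FiniteDimensional ℝ E]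

/-- Variation of constants on one interval of the partition. -/
lemma PiecewiseSolution.eq_add_transition (hA : AdmissibleCoeff t ζ γ A A₀ M M₀ θ)
    {g b : ℤ → ℝ → E} (hb : LocalParticular ζ A g b) {w : ℝ → E}
    (hw : PiecewiseSolution t ζ (inhomogeneousRHS A A₀ g) w) {k : ℤ} {s r : ℝ}
    (hs : s ∈ Icc (t k) (t (k + 1))) (hr : r ∈ Icc (t k) (t (k + 1))) :
    w s - b k s = transition t γ A A₀ s r (w r - b k r) := by
  have hB := hA.condB
  have hz := hA.piecewiseSolution_transition r (w r - b k r)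
  -- Since `b k` vanishes at `ζ k`, subtracting it leaves the delayed term of `w` intact, so `w - b
  -- k` solves the homogeneous system; its difference from the transition solution vanishes at `r`.
  have h := norm_le_exp_growthRate
    (d := fun s => w s - b k s - transition t γ A A₀ s r (w r - b k r)) hA.M_pos hA.M₀_pos
    hB.theta_pos hA.vTilde_lt_one (hB.gap_le k) (hB.zeta_mem k)
    (fun x hx => ((hw k x hx).sub (hb.hasDerivAt k x).hasDerivWithinAt).sub (hz k x hx))
    (fun x _ => by
      simp only [hb.zero, sub_zero]
      rw [show inhomogeneousRHS A A₀ g k x (w x) (w (ζ k)) - (A x (b k x) + g k x) -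
        linearRHS A A₀ x (transition t γ A A₀ x r (w r - b k r))
          (transition t γ A A₀ (ζ k) r (w r - b k r)) =
        A x (w x - b k x - transition t γ A A₀ x r (w r - b k r)) +
        A₀ x (w (ζ k) - transition t γ A A₀ (ζ k) r (w r - b k r)) by
          simp only [inhomogeneousRHS, linearRHS, map_sub]; abel]
      exact (norm_add_le _ _).trans (add_le_add ((A x).le_of_opNorm_le (hA.norm_A_le x) _)
        ((A₀ x).le_of_opNorm_le (hA.norm_A₀_le x) _))) hs hr
  simp only [hA.transition_self, sub_self, norm_zero, mul_zero] at h
  exact sub_eq_zero.1 (norm_le_zero_iff.1 h)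

/-- The value of a solution at time `t k`, pulled back to time `0`. -/
noncomputable def pullback (t : ℤ → ℝ) (γ : ℝ → ℝ) (A A₀ : ℝ → E →L[ℝ] E) (w : ℝ → E)
    (k : ℤ) : E :=
  transition t γ A A₀ 0 (t k) (w (t k))

/-- The right-hand side does not involve `w`: all solutions of the same problem have the same
pulled-back increments. -/
lemma PiecewiseSolution.pullback_succ (hA : AdmissibleCoeff t ζ γ A A₀ M M₀ θ)
    {g b : ℤ → ℝ → E} (hb : LocalParticular ζ A g b) {w : ℝ → E}
    (hw : PiecewiseSolution t ζ (inhomogeneousRHS A A₀ g) w) (k : ℤ) :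
    pullback t γ A A₀ w (k + 1) - pullback t γ A A₀ w k = increment t γ A A₀ b k := by
  have h := hw.eq_add_transition hA hb (hA.condB.mem_right k) (hA.condB.mem_left k)
  have h2 := congrArg (transition t γ A A₀ 0 (t (k + 1))) h
  rw [hA.transition_comp, map_sub, map_sub] at h2
  rw [pullback, pullback, increment, sub_eq_sub_iff_add_eq_add]
  rw [sub_eq_sub_iff_add_eq_add] at h2
  rw [h2, add_comm]

namespace DichotomousSystem

/-- A solution of the inhomogeneous system whose stable part vanishes at `-∞` and whose unstable
part vanishes at `∞` is bounded in terms of the inhomogeneity, in exponentially weighted norms. -/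
lemma norm_le_of_tendsto (hD : DichotomousSystem t ζ γ A A₀ M M₀ θ K α P)
    {g b : ℤ → ℝ → E} (hb : LocalParticular ζ A g b) {w : ℝ → E}
    (hw : PiecewiseSolution t ζ (inhomogeneousRHS A A₀ g) w)
    (hst : Tendsto (fun m => P (pullback t γ A A₀ w m)) atBot (𝓝 0))
    (hun : Tendsto (fun m => (ContinuousLinearMap.id ℝ E - P) (pullback t γ A A₀ w m))
      atTop (𝓝 0))
    {G η t₀ : ℝ} (hη : 0 ≤ η) (hηα : η < α) (hG0 : 0 ≤ G)
    (hG : ∀ k, ∀ s ∈ Icc (t k) (t (k + 1)), ‖g k s‖ ≤ G * Real.exp (η * |s - t₀|)) (s : ℝ) :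
    ‖w s‖ ≤ 2 * K * (rho t ζ A * Real.exp (α * θ)) / (α - η) * G * Real.exp (η * |s - t₀|) := by
  have hA := hD.toAdmissibleCoeff
  have hB := hD.condB
  have hK := hD.one_le_K
  have hρ := hD.rho_pos
  have hβ : 0 < α - η := by linarith
  obtain ⟨k, hk⟩ := hB.exists_mem_Ico s
  have hk' := Ico_subset_Icc_self hk
  set u := pullback t γ A A₀ w with hu
  set Z := transition t γ A A₀ with hZ
  set Q := ContinuousLinearMap.id ℝ E - P with hQ
  set c := increment t γ A A₀ b with hc
  have hus : ∀ i, u (i + 1) - u i = c i := hw.pullback_succ hA hb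
  set β := α - η with hβdef
  set R := estimateConst t ζ A θ K G η t₀ s with hR
  have hR0 : 0 ≤ R := hD.estimateConst_nonneg hG0 _ _ _
  have hC0 : 0 ≤ telescopeConst β θ := telescopeConst_nonneg hβ hB.theta_pos
  -- The stable part vanishes at `-∞`, so it is bounded by its accumulated increments over all
  -- intervals before the current one.
  have hpast : ‖Z s 0 (P (u k))‖ ≤ R * telescopeConst β θ * Real.exp (-(β * (s - t k))) := by
    have hlim : Tendsto (fun n : ℕ => Z s 0 (P (u (k - n)))) atTop (𝓝 0) := by
      have h1 : Tendsto (fun n : ℕ => k - (n : ℤ)) atTop atBot :=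
        tendsto_atBot_add_const_left _ k
          (tendsto_neg_atTop_atBot.comp tendsto_natCast_atTop_atTop)
      have := ((Z s 0).continuous.tendsto 0).comp (hst.comp h1)
      simpa [Function.comp_def] using this
    have := norm_le_of_telescope hlim
      (S := fun n : ℕ => R * telescopeConst β θ * Real.exp (-(β * (s - t (k - n)))))
      (fun n => by positivity) (fun n => by
        have h2 := hD.norm_stable_increment_le hb hη hηα hG0 hG (s := s) (k := k - n - 1)
          (by
            rw [sub_add_cancel]
            exact (hB.strictMono.monotone (by omega)).trans hk.1)
        rw [← hc, ← hus, map_sub, map_sub, sub_add_cancel] at h2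
        have e : k - ((n + 1 : ℕ) : ℤ) = k - n - 1 := by push_cast; ring
        rw [e, ← mul_sub]
        exact h2)
    simpa using this
  have hfut : ‖Z s 0 (Q (u (k + 1)))‖ ≤
      R * telescopeConst β θ * Real.exp (-(β * (t (k + 1) - s))) := by
    have hlim : Tendsto (fun n : ℕ => Z s 0 (Q (u (k + 1 + n)))) atTop (𝓝 0) := by
      have h1 : Tendsto (fun n : ℕ => k + 1 + (n : ℤ)) atTop atTop :=
        tendsto_atTop_add_const_left _ _ tendsto_natCast_atTop_atTop
      have := ((Z s 0).continuous.tendsto 0).comp (hun.comp h1)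
      simpa [Function.comp_def] using this
    have := norm_le_of_telescope hlim
      (S := fun n : ℕ => R * telescopeConst β θ * Real.exp (-(β * (t (k + 1 + n) - s))))
      (fun n => by positivity) (fun n => by
        have h2 := hD.norm_unstable_increment_le hb hη hηα hG0 hG (s := s) (k := k + 1 + n)
          (hk.2.trans_le (hB.strictMono.monotone (by omega)))
        rw [← hc, ← hus, map_sub, map_sub, norm_sub_rev] at h2
        have e : k + 1 + ((n + 1 : ℕ) : ℤ) = k + 1 + n + 1 := by push_cast; ring
        rw [e, ← mul_sub]
        exact h2)
    simpa using this
  have hGk : ∀ r ∈ Icc (t k) (t (k + 1)), ‖g k r‖ ≤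
      G * Real.exp (η * (|s - t₀| + θ)) := fun r hr => by
    refine (hG k r hr).trans ?_
    gcongr
    have h1 : |r - t₀| ≤ |r - s| + |s - t₀| := abs_sub_le _ _ _
    have h2 := hB.abs_sub_le hr hk'
    linarith
  have hz := hB.zeta_mem k
  have hgap := hB.gap_le k
  have hGR : K * (G * Real.exp (η * (|s - t₀| + θ)) * rho t ζ A) = R := by
    rw [hR, estimateConst, mul_add, Real.exp_add]; ring
  have hb1 : K * ‖b k (t k)‖ ≤ R * (ζ k - t k) := by
    have := hb.norm_le hA hGk (hB.mem_left k)
    rw [abs_of_nonpos (a := t k - ζ k) (by linarith [hz.1])] at this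
    rw [← hGR, mul_assoc K]
    gcongr
    linarith
  have hb2 : K * ‖b k (t (k + 1))‖ ≤ R * (t (k + 1) - ζ k) := by
    have := hb.norm_le hA hGk (hB.mem_right k)
    rw [abs_of_nonneg (a := t (k + 1) - ζ k) (by linarith [hz.2])] at this
    rw [← hGR, mul_assoc K]
    gcongr
  have hb3 : ‖b k s‖ ≤ R * |ζ k - t k - (s - t k)| := by
    have := hb.norm_le hA hGk hk'
    rw [← hGR, show ζ k - t k - (s - t k) = -(s - ζ k) by ring, abs_neg, mul_assoc K]
    exact this.trans (le_mul_of_one_le_left ((norm_nonneg _).trans this) hK)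
  have hdecay : ∀ y, 0 ≤ y → Real.exp (-(α * y)) ≤ Real.exp (-(β * y)) := fun y hy =>
    Real.exp_le_exp.2 (by nlinarith)
  have hl1 : ‖Z s 0 (P (Z 0 (t k) (b k (t k))))‖ ≤
      R * ((ζ k - t k) * Real.exp (-(β * (s - t k)))) := by
    have h1 := hD.norm_stable_le hk.1 (b k (t k))
    have h2 := hdecay (s - t k) (by linarith [hk.1])
    calc _ ≤ _ := h1
      _ = K * ‖b k (t k)‖ * Real.exp (-(α * (s - t k))) := by ring
      _ ≤ R * (ζ k - t k) * Real.exp (-(β * (s - t k))) := by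
        gcongr
        exact mul_nonneg hR0 (by linarith [hz.1])
      _ = _ := by ring
  have hl2 : ‖Z s 0 (Q (Z 0 (t (k + 1)) (b k (t (k + 1)))))‖ ≤
      R * ((t (k + 1) - ζ k) * Real.exp (-(β * (t (k + 1) - s)))) := by
    have h1 := hD.norm_unstable_le hk.2 (b k (t (k + 1)))
    have h2 := hdecay (t (k + 1) - s) (by linarith [hk.2])
    calc _ ≤ _ := h1
      _ = K * ‖b k (t (k + 1))‖ * Real.exp (-(α * (t (k + 1) - s))) := by ring
      _ ≤ R * (t (k + 1) - ζ k) * Real.exp (-(β * (t (k + 1) - s))) := by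
        gcongr
        exact mul_nonneg hR0 (by linarith [hz.2])
      _ = _ := by ring
  -- On the current interval `w - b k` is homogeneous. Its stable part is read off at the left
  -- endpoint and its unstable part at the right one, so that each is propagated in its decaying
  -- direction.
  have hrep : w s = Z s 0 (P (u k)) - Z s 0 (P (Z 0 (t k) (b k (t k)))) +
      (Z s 0 (Q (u (k + 1))) - Z s 0 (Q (Z 0 (t (k + 1)) (b k (t (k + 1)))))) + b k s := by
    have h1 := hw.eq_add_transition hA hb hk' (hB.mem_left k)
    rw [← hA.transition_comp s 0 (t k), map_sub] at h1
    have h2 : u (k + 1) - Z 0 (t (k + 1)) (b k (t (k + 1))) = u k - Z 0 (t k) (b k (t k)) := by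
      have := hus k
      rw [hc, increment, sub_eq_sub_iff_add_eq_add] at this
      rw [sub_eq_sub_iff_add_eq_add]
      exact this.trans (add_comm _ _)
    rw [← map_sub, ← map_sub, ← map_sub, ← map_sub, h2, ← map_add]
    have h3 : ∀ x, P x + Q x = x := fun x => by simp [hQ]
    rw [h3]
    exact sub_eq_iff_eq_add.1 h1
  have hcost := switching_cost_le (β := β) (θ := θ) (p := s - t k) (q := t (k + 1) - s)
    (z := ζ k - t k) hβ (by linarith [hk.1]) (by linarith [hk.2]) (by linarith)
    (by linarith [hz.1]) (by linarith [hz.2])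
  rw [← telescopeConst, show s - t k + (t (k + 1) - s) - (ζ k - t k) = t (k + 1) - ζ k by ring]
    at hcost
  have htri : ‖w s‖ ≤ ‖Z s 0 (P (u k))‖ + ‖Z s 0 (P (Z 0 (t k) (b k (t k))))‖ +
      (‖Z s 0 (Q (u (k + 1)))‖ + ‖Z s 0 (Q (Z 0 (t (k + 1)) (b k (t (k + 1)))))‖) + ‖b k s‖ := by
    rw [hrep]
    exact (norm_add_le _ _).trans (add_le_add ((norm_add_le _ _).trans
      (add_le_add (norm_sub_le _ _) (norm_sub_le _ _))) le_rfl)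
  calc ‖w s‖ ≤ R * (telescopeConst β θ *
        (Real.exp (-(β * (s - t k))) + Real.exp (-(β * (t (k + 1) - s)))) +
        ((ζ k - t k) * Real.exp (-(β * (s - t k))) +
          (t (k + 1) - ζ k) * Real.exp (-(β * (t (k + 1) - s))) +
          |ζ k - t k - (s - t k)|)) := by linarith
    _ ≤ R * (2 * Real.exp (β * θ) / β) := by gcongr
    _ = _ := by
      rw [hR, estimateConst, show α * θ = η * θ + β * θ by rw [hβdef]; ring, Real.exp_add]
      ring

/-- For a bounded inhomogeneity there is a solution that satisfies the hypotheses of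
`norm_le_of_tendsto`. -/
lemma exists_tendsto (hD : DichotomousSystem t ζ γ A A₀ M M₀ θ K α P)
    {g b : ℤ → ℝ → E} (hb : LocalParticular ζ A g b) (hg : ∀ k, Continuous (g k)) {G : ℝ}
    (hG : ∀ k s, ‖g k s‖ ≤ G) :
    ∃ w, PiecewiseSolution t ζ (inhomogeneousRHS A A₀ g) w ∧
      Tendsto (fun m => P (pullback t γ A A₀ w m)) atBot (𝓝 0) ∧
      Tendsto (fun m => (ContinuousLinearMap.id ℝ E - P) (pullback t γ A A₀ w m))
        atTop (𝓝 0) := by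
  have := FiniteDimensional.complete ℝ E
  have hA := hD.toAdmissibleCoeff
  have hB := hD.condB
  have hα := hD.α_pos
  have hG0 : 0 ≤ G := (norm_nonneg _).trans (hG 0 0)
  have hG' : ∀ k, ∀ s ∈ Icc (t k) (t (k + 1)), ‖g k s‖ ≤ G * Real.exp (0 * |s - 0|) := by
    intro k s _
    simpa using hG k s
  obtain ⟨k, hk⟩ := hB.exists_mem_Ico 0
  set Z := transition t γ A A₀ with hZ
  set Q := ContinuousLinearMap.id ℝ E - P with hQ
  set c := increment t γ A A₀ b with hc
  set R := estimateConst t ζ A θ K G 0 0 0 with hR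
  have hR0 : 0 ≤ R := hD.estimateConst_nonneg hG0 _ _ _
  have hC0 := telescopeConst_nonneg hα hB.theta_pos
  have hs1 : Summable fun n : ℕ => P (c (k - n - 1)) :=
    summable_of_telescope
      (S := fun n : ℕ => R * telescopeConst α θ * Real.exp (-(α * (0 - t (k - n)))))
      (fun n => by positivity) (fun n => by
        have h2 := hD.norm_stable_increment_le hb le_rfl hα hG0 hG' (s := 0) (k := k - n - 1)
          (by
            rw [sub_add_cancel]
            exact (hB.strictMono.monotone (by omega)).trans hk.1)
        rw [hA.transition_self, sub_add_cancel, sub_zero] at h2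
        have e : k - ((n + 1 : ℕ) : ℤ) = k - n - 1 := by push_cast; ring
        rw [e, ← mul_sub]
        exact h2)
  have hs2 : Summable fun n : ℕ => Q (c (k + 1 + n)) :=
    summable_of_telescope
      (S := fun n : ℕ => R * telescopeConst α θ * Real.exp (-(α * (t (k + 1 + n) - 0))))
      (fun n => by positivity) (fun n => by
        have h2 := hD.norm_unstable_increment_le hb le_rfl hα hG0 hG' (s := 0) (k := k + 1 + n)
          (hk.2.trans_le (hB.strictMono.monotone (by omega)))
        rw [hA.transition_self, sub_zero] at h2
        have e : k + 1 + ((n + 1 : ℕ) : ℤ) = k + 1 + n + 1 := by push_cast; ring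
        rw [e, ← mul_sub]
        exact h2)
  set a₁ := ∑' n : ℕ, P (c (k - n - 1)) with ha₁
  set a₂ := ∑' n : ℕ, Q (c (k + 1 + n)) with ha₂
  have hPQ : ∀ x, P (Q x) = 0 := fun x => by simp [hQ, hD.proj]
  have hQP : ∀ x, Q (P x) = 0 := fun x => by simp [hQ, hD.proj]
  have hQQ : ∀ x, Q (Q x) = Q x := fun x => by
    have h : ∀ y, Q y = y - P y := fun y => by simp [hQ]
    rw [h (Q x), hPQ, sub_zero]
  have hPa₁ : P a₁ = a₁ := by
    rw [ha₁, P.map_tsum hs1]; simp only [hD.proj]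
  have hQa₁ : Q a₁ = 0 := by rw [← hPa₁, hQP]
  have hQa₂ : Q a₂ = a₂ := by
    rw [ha₂, Q.map_tsum hs2]; simp only [hQQ]
  have hPa₂ : P a₂ = 0 := by rw [← hQa₂, hPQ]
  -- The stable part is the sum of past increments and the unstable part minus the sum of future
  -- ones. Unstable decay is available only for nodes after time `0`, so `a₂` starts at `k + 1`, and
  -- `Q (c k)` is subtracted to give `Q (u (k + 1)) = -a₂`.
  obtain ⟨w, hw, hwk⟩ := exists_piecewiseSolution hB (hA.lipschitz_inhomogeneous hg hG)
    hA.vTilde_lt_one (t k) (Z (t k) 0 (a₁ - a₂ - Q (c k)))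
  set u := pullback t γ A A₀ w with hu
  have hus : ∀ i, u (i + 1) - u i = c i := hw.pullback_succ hA hb
  have huk : u k = a₁ - a₂ - Q (c k) := by
    rw [hu, pullback, hwk, hA.transition_comp, hA.transition_self]
  refine ⟨w, hw, ?_, ?_⟩
  · have key : ∀ n : ℕ, P (u (k - n)) = a₁ - ∑ i ∈ Finset.range n, P (c (k - i - 1)) := by
      intro n
      induction n with
      | zero => simp [huk, hPa₁, hPa₂, hPQ]
      | succ n ih =>
        have e : k - ((n + 1 : ℕ) : ℤ) = k - n - 1 := by push_cast; ring
        have h1 := hus (k - n - 1)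
        rw [sub_add_cancel] at h1
        rw [Finset.sum_range_succ, ← sub_sub, ← ih, ← h1, map_sub, e]
        abel
    have h0 : Tendsto (fun n : ℕ => P (u (k - n))) atTop (𝓝 0) := by
      simp only [key]
      have := (tendsto_const_nhds (x := a₁)).sub hs1.hasSum.tendsto_sum_nat
      rwa [← ha₁, sub_self] at this
    have h1 : Tendsto (fun m : ℤ => (k - m).toNat) atBot atTop :=
      tendsto_atTop.2 fun n => (eventually_le_atBot (k - n)).mono fun m hm => by omega
    refine (h0.comp h1).congr' ?_
    filter_upwards [eventually_le_atBot k] with m hm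
    simp only [Function.comp_apply]
    congr 3
    omega
  · have key : ∀ n : ℕ, Q (u (k + 1 + n)) =
        (∑ i ∈ Finset.range n, Q (c (k + 1 + i))) - a₂ := by
      intro n
      induction n with
      | zero =>
        have h1 := hus k
        rw [sub_eq_iff_eq_add] at h1
        simp [h1, huk, hQa₁, hQa₂, hQQ]
      | succ n ih =>
        have e : k + 1 + ((n + 1 : ℕ) : ℤ) = k + 1 + n + 1 := by push_cast; ring
        have h1 := hus (k + 1 + n)
        rw [Finset.sum_range_succ, ← h1, map_sub, e, ih]
        abel
    have h0 : Tendsto (fun n : ℕ => Q (u (k + 1 + n))) atTop (𝓝 0) := by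
      simp only [key]
      have := hs2.hasSum.tendsto_sum_nat.sub (tendsto_const_nhds (x := a₂))
      rwa [← ha₂, sub_self] at this
    have h1 : Tendsto (fun m : ℤ => (m - (k + 1)).toNat) atTop atTop :=
      tendsto_atTop.2 fun n => (eventually_ge_atTop (k + 1 + n)).mono fun m hm => by omega
    refine (h0.comp h1).congr' ?_
    filter_upwards [eventually_ge_atTop (k + 1)] with m hm
    simp only [Function.comp_apply]
    congr 3
    omega

end DichotomousSystem

end BoundedSolutions

/-! ### Companion solutions at bounded distance and their Hölder dependence. -/

section Nonlinear

variable {E : Type*} [NormedAddCommGroup E] [NormedSpace ℝ E] {t ζ : ℤ → ℝ} {γ : ℝ → ℝ}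
  {A A₀ : ℝ → E →L[ℝ] E} {f h : ℝ → E → E → E}

lemma ConditionA.continuous_comp {M M₀ μ ℓ₁ ℓ₂ : ℝ} (hf : ConditionA A A₀ f M M₀ μ ℓ₁ ℓ₂)
    {u : ℝ → E} (hu : Continuous u) (y : E) : Continuous fun s => f s (u s) y :=
  continuousOn_univ.1 <| continuous_comp_of_lipschitz (F := fun s x => f s x y)
    (fun x => hf.continuous_f x y) (fun s x x' => by simpa using hf.lipschitz_f s x x' y y)
    hu.continuousOn

lemma PiecewiseSolution.sub_perturbed {x y : ℝ → E}
    (hx : PiecewiseSolution t ζ (fun _ => perturbedRHS A A₀ f) x)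
    (hy : PiecewiseSolution t ζ (fun _ => perturbedRHS A A₀ h) y) :
    PiecewiseSolution t ζ
      (inhomogeneousRHS A A₀ fun k s => h s (y s) (y (ζ k)) - f s (x s) (x (ζ k)))
      fun s => y s - x s := fun k s hs => by
  refine ((hy k s hs).sub (hx k s hs)).congr_deriv ?_
  simp only [perturbedRHS, inhomogeneousRHS, linearRHS, map_sub]
  abel

lemma PiecewiseSolution.add_perturbed {x w : ℝ → E}
    (hx : PiecewiseSolution t ζ (fun _ => perturbedRHS A A₀ f) x)
    (hw : PiecewiseSolution t ζ (inhomogeneousRHS A A₀ fun k s =>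
      h s (x s + w s) (x (ζ k) + w (ζ k)) - f s (x s) (x (ζ k))) w) :
    PiecewiseSolution t ζ (fun _ => perturbedRHS A A₀ h) fun s => x s + w s := fun k s hs => by
  refine ((hx k s hs).add (hw k s hs)).congr_deriv ?_
  simp only [perturbedRHS, inhomogeneousRHS, linearRHS, map_add]
  abel

namespace StrongHypWith

variable {M M₀ μ ℓ₁ ℓ₂ θ K α : ℝ}

lemma admissible (hf : StrongHypWith t ζ γ A A₀ f M M₀ μ ℓ₁ ℓ₂ θ K α) :
    AdmissibleCoeff t ζ γ A A₀ M M₀ θ where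
  condB := hf.condB
  continuous_A := hf.condA.continuous_A
  continuous_A₀ := hf.condA.continuous_A₀
  M_pos := hf.condA.M_pos
  M₀_pos := hf.condA.M₀_pos
  norm_A_le := hf.condA.norm_A_le
  norm_A₀_le := hf.condA.norm_A₀_le
  vTilde_lt_one := hf.vTilde_lt_one

lemma exists_dichotomousSystem (hf : StrongHypWith t ζ γ A A₀ f M M₀ μ ℓ₁ ℓ₂ θ K α) :
    ∃ P, DichotomousSystem t ζ γ A A₀ M M₀ θ K α P := by
  obtain ⟨hK, hα, P, hP, hker⟩ := hf.dichotomy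
  exact ⟨P, hf.admissible, hK, hα, fun x => congrArg (fun T : E →L[ℝ] E => T x) hP, hker⟩

lemma lipschitz_perturbed (hf : StrongHypWith t ζ γ A A₀ f M M₀ μ ℓ₁ ℓ₂ θ K α) :
    LipschitzRHS (fun _ : ℤ => perturbedRHS A A₀ f) (M + ℓ₁) (M₀ + ℓ₂) where
  pos_a := add_pos hf.condA.M_pos hf.condA.ℓ₁_pos
  pos_b := add_pos hf.condA.M₀_pos hf.condA.ℓ₂_pos
  continuous k x y := by
    have := hf.condA.continuous_A
    have := hf.condA.continuous_A₀
    have := hf.condA.continuous_f x y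
    unfold perturbedRHS
    fun_prop
  lipschitz k s x x' y y' := by
    have h1 := hf.admissible.lipschitz_linear.lipschitz k s x x' y y'
    have h2 := hf.condA.lipschitz_f s x x' y y'
    have h3 : perturbedRHS A A₀ f s x y - perturbedRHS A A₀ f s x' y' =
        (linearRHS A A₀ s x y - linearRHS A A₀ s x' y') + (f s x y - f s x' y') := by
      simp only [perturbedRHS, linearRHS]; abel
    rw [h3]
    refine (norm_add_le _ _).trans ?_
    linarith
  bounded := ⟨μ, fun k s => by simpa [perturbedRHS] using hf.condA.norm_f_le s 0 0⟩

end StrongHypWith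

namespace DichotomousSystem

variable {M M₀ θ K α : ℝ} {P : E →L[ℝ] E} [FiniteDimensional ℝ E]

/-- The dichotomy from `t m` to `0` makes these parts of a bounded function decay like `e^{-α|t
m|}`. Hence every bounded solution satisfies the conditions at infinity, which also gives
uniqueness. -/
lemma tendsto_of_bounded (hD : DichotomousSystem t ζ γ A A₀ M M₀ θ K α P) {w : ℝ → E} {C : ℝ}
    (hC : ∀ s, ‖w s‖ ≤ C) :
    Tendsto (fun m => P (pullback t γ A A₀ w m)) atBot (𝓝 0) ∧
      Tendsto (fun m => (ContinuousLinearMap.id ℝ E - P) (pullback t γ A A₀ w m))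
        atTop (𝓝 0) := by
  have hA := hD.toAdmissibleCoeff
  have hK := hD.one_le_K
  have hlim : Tendsto (fun r : ℝ => K * Real.exp (-(α * r)) * C) atTop (𝓝 (K * 0 * C)) :=
    ((Real.tendsto_exp_neg_atTop_nhds_zero.comp
      (tendsto_id.const_mul_atTop hD.α_pos)).const_mul K).mul_const C
  simp only [mul_zero, zero_mul] at hlim
  constructor
  · refine squeeze_zero_norm' ?_ (hlim.comp (tendsto_neg_atBot_atTop.comp hD.condB.tendsto_bot))
    filter_upwards [hD.condB.tendsto_bot.eventually_le_atBot 0] with m hm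
    have h1 := hD.norm_stable_le hm (w (t m))
    rw [hA.transition_self, zero_sub] at h1
    refine h1.trans ?_
    simp only [Function.comp_apply]
    gcongr
    exact hC _
  · refine squeeze_zero_norm' ?_ (hlim.comp hD.condB.tendsto_top)
    filter_upwards [hD.condB.tendsto_top.eventually_gt_atTop 0] with m hm
    have h1 := hD.norm_unstable_le hm (w (t m))
    rw [hA.transition_self, sub_zero] at h1
    refine h1.trans ?_
    simp only [Function.comp_apply]
    gcongr
    exact hC _

/-- Weighted estimate for bounded solutions of the inhomogeneous system. -/
lemma norm_le_of_bounded (hD : DichotomousSystem t ζ γ A A₀ M M₀ θ K α P)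
    {g : ℤ → ℝ → E} (hg : ∀ k, Continuous (g k)) {C : ℝ} (hC : ∀ k s, ‖g k s‖ ≤ C) {w : ℝ → E}
    (hw : PiecewiseSolution t ζ (inhomogeneousRHS A A₀ g) w) {B : ℝ} (hB : ∀ s, ‖w s‖ ≤ B)
    {G η t₀ : ℝ} (hη : 0 ≤ η) (hηα : η < α) (hG0 : 0 ≤ G)
    (hG : ∀ k, ∀ s ∈ Icc (t k) (t (k + 1)), ‖g k s‖ ≤ G * Real.exp (η * |s - t₀|)) (s : ℝ) :
    ‖w s‖ ≤ 2 * K * (rho t ζ A * Real.exp (α * θ)) / (α - η) * G * Real.exp (η * |s - t₀|) := by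
  have := FiniteDimensional.complete ℝ E
  obtain ⟨b, hb⟩ := hD.exists_localParticular hg hC
  obtain ⟨h1, h2⟩ := hD.tendsto_of_bounded hB
  exact hD.norm_le_of_tendsto hb hw h1 h2 hη hηα hG0 hG s

lemma exists_bounded (hD : DichotomousSystem t ζ γ A A₀ M M₀ θ K α P)
    {g : ℤ → ℝ → E} (hg : ∀ k, Continuous (g k)) {G : ℝ} (hG : ∀ k s, ‖g k s‖ ≤ G) :
    ∃ w, PiecewiseSolution t ζ (inhomogeneousRHS A A₀ g) w ∧
      ∀ s, ‖w s‖ ≤ 2 * K * (rho t ζ A * Real.exp (α * θ)) / α * G := by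
  have := FiniteDimensional.complete ℝ E
  obtain ⟨b, hb⟩ := hD.exists_localParticular hg hG
  obtain ⟨w, hw, h1, h2⟩ := hD.exists_tendsto hb hg hG
  refine ⟨w, hw, fun s => ?_⟩
  have := hD.norm_le_of_tendsto hb hw h1 h2 le_rfl hD.α_pos ((norm_nonneg _).trans (hG 0 0))
    (t₀ := 0) (fun k s _ => by simpa using hG k s) s
  simpa using this

end DichotomousSystem

variable {M M₀ μ ℓ₁ ℓ₂ θ K α M' M₀' μ' ℓ₁' ℓ₂' θ' K' α' : ℝ} [FiniteDimensional ℝ E]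

open BoundedContinuousFunction in
/-- Every solution of the system perturbed by `f` has a solution of the system perturbed by `h` at
bounded distance. -/
lemma StrongHypWith.exists_near
    (hh : StrongHypWith t ζ γ A A₀ h M M₀ μ ℓ₁ ℓ₂ θ K α)
    (hf : ConditionA A A₀ f M' M₀' μ' ℓ₁' ℓ₂') :
    ∃ C, ∀ x, PiecewiseSolution t ζ (fun _ => perturbedRHS A A₀ f) x →
      ∃ y, PiecewiseSolution t ζ (fun _ => perturbedRHS A A₀ h) y ∧ ∀ s, ‖y s - x s‖ ≤ C := by
  have := FiniteDimensional.complete ℝ E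
  obtain ⟨P, hD⟩ := hh.exists_dichotomousSystem
  have hα := hD.α_pos
  have hℓ₁ := hh.condA.ℓ₁_pos
  have hℓ₂ := hh.condA.ℓ₂_pos
  set κ := 2 * K * (rho t ζ A * Real.exp (α * θ)) / α with hκ
  have hκ0 : 0 ≤ κ := by
    have := hD.rho_pos
    have := hD.one_le_K
    positivity
  refine ⟨κ * (μ + μ'), fun x hx => ?_⟩
  have hxc := hx.continuous hh.condB
  let g : (ℝ →ᵇ E) → ℤ → ℝ → E := fun w k s =>
    h s (x s + w s) (x (ζ k) + w (ζ k)) - f s (x s) (x (ζ k))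
  have hgc : ∀ w k, Continuous (g w k) := fun w k =>
    (hh.condA.continuous_comp (hxc.add w.continuous) _).sub (hf.continuous_comp hxc _)
  have hgb : ∀ w k s, ‖g w k s‖ ≤ μ + μ' := fun w k s =>
    (norm_sub_le _ _).trans (add_le_add (hh.condA.norm_f_le _ _ _) (hf.norm_f_le _ _ _))
  choose T hT hTb using fun w => hD.exists_bounded (hgc w) (hgb w)
  let T' : (ℝ →ᵇ E) → (ℝ →ᵇ E) := fun w =>
    ofNormedAddCommGroup (T w) ((hT w).continuous hh.condB) _ (hTb w)
  have hq0 : 0 ≤ κ * (ℓ₁ + ℓ₂) := by positivity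
  have hcontr : ContractingWith (κ * (ℓ₁ + ℓ₂)).toNNReal T' := by
    constructor
    · have hsmall := hh.small
      have : κ * (ℓ₁ + ℓ₂) < 1 := by
        rw [hκ, div_mul_eq_mul_div, div_lt_one hα]
        linarith
      simpa [← NNReal.coe_lt_coe] using this
    · refine LipschitzWith.of_dist_le_mul fun w w' => ?_
      rw [Real.coe_toNNReal _ hq0, BoundedContinuousFunction.dist_le (by positivity)]
      intro s
      rw [dist_eq_norm]
      -- The difference of two images is itself a bounded solution, so the unweighted estimate (`η =
      -- 0`) applies; the factor `κ(ℓ₁ + ℓ₂)` is less than `1` by the smallness hypothesis.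
      have h1 := hD.norm_le_of_bounded (fun k => (hgc w k).sub (hgc w' k))
        (fun k s => (norm_sub_le _ _).trans (add_le_add (hgb w k s) (hgb w' k s)))
        ((hT w).sub (hT w')) (fun s => (norm_sub_le _ _).trans (add_le_add (hTb w s) (hTb w' s)))
        (G := (ℓ₁ + ℓ₂) * dist w w') (t₀ := 0) le_rfl hα (by positivity)
        (fun k s _ => by
          have h2 := hh.condA.lipschitz_f s (x s + w s) (x s + w' s)
            (x (ζ k) + w (ζ k)) (x (ζ k) + w' (ζ k))
          simp only [add_sub_add_left_eq_sub, ← dist_eq_norm (w _) (w' _)] at h2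
          simp only [g, Pi.sub_apply, sub_sub_sub_cancel_right, zero_mul, Real.exp_zero, mul_one]
          refine h2.trans ?_
          have h3 := w.dist_coe_le_dist (g := w') s
          have h4 := w.dist_coe_le_dist (g := w') (ζ k)
          rw [add_mul]
          gcongr) s
      rw [sub_zero, zero_mul, Real.exp_zero, mul_one, ← mul_assoc, ← hκ] at h1
      exact h1
  set w := hcontr.fixedPoint T' with hw
  have hfix : T w = w := congrArg DFunLike.coe (hcontr.fixedPoint_isFixedPt : T' w = w)
  have hsol := hT w
  have hbd := hTb w
  rw [hfix] at hsol hbd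
  exact ⟨fun s => x s + w s, hx.add_perturbed hsol, fun s => by simpa using hbd s⟩

/-- Interpolation between a bound and a Lipschitz estimate: `U ≤ U^c` below `1`, and `1 ≤ U^c`
above. -/
lemma le_mul_rpow_of_le {n m L U c : ℝ} (hc : 0 < c) (hc1 : c ≤ 1) (hL : 0 ≤ L) (hm : 0 ≤ m)
    (hU : 0 ≤ U) (h1 : n ≤ m) (h2 : n ≤ L * U) : n ≤ (L + m) * U ^ c := by
  rcases le_total U 1 with h | h
  · have h3 : U ≤ U ^ c := by
      simpa using Real.rpow_le_rpow_of_exponent_ge' hU h hc.le hc1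
    have h4 : 0 ≤ U ^ c := Real.rpow_nonneg hU c
    nlinarith
  · have h3 : 1 ≤ U ^ c := Real.one_le_rpow h hc.le
    nlinarith

/-- At `η = 0` the last inequality is the smallness hypothesis; being strict, it persists for small
`η` by continuity. -/
lemma exists_weight {a b θ α p : ℝ} (hα : 0 < α) (hp : 0 < p) (hab : a * b < α) :
    ∃ η, 0 < η ∧ η < α ∧ η < p ∧ b / (α - η) * (a * Real.exp (η * θ)) < 1 := by
  have hcont : ContinuousAt (fun η : ℝ => b / (α - η) * (a * Real.exp (η * θ))) 0 := by
    refine ContinuousAt.mul (continuousAt_const.div (by fun_prop) (by simpa using hα.ne'))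
      (by fun_prop)
  have h0 : b / (α - 0) * (a * Real.exp (0 * θ)) < 1 := by
    rw [sub_zero, zero_mul, Real.exp_zero, mul_one, div_mul_eq_mul_div, div_lt_one hα]
    linarith
  have h1 : ∀ᶠ η in 𝓝[>] (0 : ℝ), b / (α - η) * (a * Real.exp (η * θ)) < 1 :=
    (hcont.eventually_lt continuousAt_const h0).filter_mono nhdsWithin_le_nhds
  have h2 : ∀ᶠ η in 𝓝[>] (0 : ℝ), η ∈ Ioo 0 α := Ioo_mem_nhdsGT hα
  have h3 : ∀ᶠ η in 𝓝[>] (0 : ℝ), η ∈ Ioo 0 p := Ioo_mem_nhdsGT hp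
  obtain ⟨η, h1, h2, h3⟩ := (h1.and (h2.and h3)).exists
  exact ⟨η, h2.1, h2.2, h3.2, h1⟩

/-- Hölder dependence of the distance between solutions of the two perturbed systems at bounded
distance. In particular, a solution of the second system at bounded distance from a given solution
of the first one is unique. -/
lemma StrongHypWith.norm_sub_le_rpow
    (hf : StrongHypWith t ζ γ A A₀ f M' M₀' μ' ℓ₁' ℓ₂' θ' K' α')
    (hh : StrongHypWith t ζ γ A A₀ h M M₀ μ ℓ₁ ℓ₂ θ K α) :
    ∃ C c : ℝ, 0 ≤ C ∧ 0 < c ∧ c < 1 ∧ ∀ x x' y y' : ℝ → E,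
      PiecewiseSolution t ζ (fun _ => perturbedRHS A A₀ f) x →
      PiecewiseSolution t ζ (fun _ => perturbedRHS A A₀ f) x' →
      PiecewiseSolution t ζ (fun _ => perturbedRHS A A₀ h) y →
      PiecewiseSolution t ζ (fun _ => perturbedRHS A A₀ h) y' →
      (∃ B, ∀ s, ‖y s - x s‖ ≤ B) → (∃ B, ∀ s, ‖y' s - x' s‖ ≤ B) →
      ∀ s, ‖(y s - x s) - (y' s - x' s)‖ ≤ C * ‖x s - x' s‖ ^ c := by
  obtain ⟨P, hD⟩ := hh.exists_dichotomousSystem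
  have hB := hh.condB
  have hα := hD.α_pos
  have hK := hD.one_le_K
  have hρ := hD.rho_pos
  have hθ := hB.theta_pos
  have hℓ₁ := hh.condA.ℓ₁_pos
  have hℓ₂ := hh.condA.ℓ₂_pos
  have hμ := hh.condA.μ_pos
  have hℓ₁' := hf.condA.ℓ₁_pos
  have hℓ₂' := hf.condA.ℓ₂_pos
  have hμ' := hf.condA.μ_pos
  have hF := hf.lipschitz_perturbed
  have hv : expQuot (M' + ℓ₁') θ' * (M₀' + ℓ₂') * θ' < 1 := hf.v_lt_one
  set p := growthRate (M' + ℓ₁') (M₀' + ℓ₂') θ' with hp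
  have hp0 : 0 < p := growthRate_pos hF.pos_a hF.pos_b hv
  obtain ⟨η, hη0, hηα, hηp, hq1⟩ := exists_weight (a := ℓ₁ + ℓ₂)
    (b := 2 * K * (rho t ζ A * Real.exp (α * θ))) (θ := θ) hα hp0 (by linarith [hh.small])
  set κ := 2 * K * (rho t ζ A * Real.exp (α * θ)) / (α - η) with hκ
  set q := κ * ((ℓ₁ + ℓ₂) * Real.exp (η * θ)) with hq
  have hαη : 0 < α - η := by linarith
  have hκ0 : 0 ≤ κ := by positivity
  have hq0 : 0 ≤ q := by positivity
  set D := (ℓ₁ + ℓ₂ + (μ + μ)) + (ℓ₁' + ℓ₂' + (μ' + μ')) with hDdef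
  have hD0 : 0 ≤ D := by positivity
  -- This exponent turns the separation bound `e^{p|s - t₀|}δ` into `e^{η|s - t₀|}δ^c`, the growth
  -- that the weight tolerates.
  set c := η / p with hc
  have hc0 : 0 < c := by positivity
  have hc1 : c < 1 := (div_lt_one hp0).2 hηp
  have hpc : p * c = η := by rw [hc]; field_simp
  refine ⟨κ * (D * Real.exp (η * θ)) / (1 - q), c, ?_, hc0, hc1, ?_⟩
  · have : 0 < 1 - q := by linarith
    positivity
  rintro x x' y y' hx hx' hy hy' ⟨B, hyx⟩ ⟨B', hyx'⟩ t₀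
  have hxc := hx.continuous hB
  have hxc' := hx'.continuous hB
  have hyc := hy.continuous hB
  have hyc' := hy'.continuous hB
  set δ := ‖x t₀ - x' t₀‖ with hδ
  have hδ0 : 0 ≤ δ := norm_nonneg _
  have hδc : 0 ≤ δ ^ c := Real.rpow_nonneg hδ0 c
  set Δ : ℝ → E := fun s => (y s - x s) - (y' s - x' s) with hΔ
  set a := κ * (D * Real.exp (η * θ) * δ ^ c) with ha
  have ha0 : 0 ≤ a := by positivity
  have hgrow : ∀ s, ‖x s - x' s‖ ≤ Real.exp (p * |s - t₀|) * δ := fun s =>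
    hx.norm_sub_le hf.condB hF hv hx' s t₀
  have hBB : ∀ s, ‖Δ s‖ ≤ B + B' := fun s =>
    (norm_sub_le _ _).trans (add_le_add (hyx s) (hyx' s))
  have hstep : ∀ N, 0 ≤ N → (∀ s, ‖Δ s‖ ≤ N * Real.exp (η * |s - t₀|)) →
      ∀ s, ‖Δ s‖ ≤ (a + q * N) * Real.exp (η * |s - t₀|) := by
    intro N hN hΔN s
    have hmain := hD.norm_le_of_bounded
      (g := fun k s => (h s (y s) (y (ζ k)) - f s (x s) (x (ζ k))) -
        (h s (y' s) (y' (ζ k)) - f s (x' s) (x' (ζ k))))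
      (fun k => ((hh.condA.continuous_comp hyc _).sub (hf.condA.continuous_comp hxc _)).sub
        ((hh.condA.continuous_comp hyc' _).sub (hf.condA.continuous_comp hxc' _)))
      (C := (μ + μ') + (μ + μ'))
      (fun k s => (norm_sub_le _ _).trans (add_le_add
        ((norm_sub_le _ _).trans (add_le_add (hh.condA.norm_f_le _ _ _) (hf.condA.norm_f_le _ _ _)))
        ((norm_sub_le _ _).trans
          (add_le_add (hh.condA.norm_f_le _ _ _) (hf.condA.norm_f_le _ _ _)))))
      ((hx.sub_perturbed hy).sub (hx'.sub_perturbed hy')) hBB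
      (G := D * Real.exp (η * θ) * δ ^ c + (ℓ₁ + ℓ₂) * Real.exp (η * θ) * N) (t₀ := t₀)
      hη0.le hηα (by positivity) (fun k r hr => ?_) s
    · refine hmain.trans (le_of_eq ?_)
      rw [ha, hq]; ring
    have hζ : |ζ k - t₀| ≤ θ + |r - t₀| :=
      (abs_sub_le _ r _).trans (add_le_add (hB.abs_sub_le (hB.zeta_mem k) hr) le_rfl)
    have hr' : |r - t₀| ≤ θ + |r - t₀| := by linarith
    set U := Real.exp (p * (θ + |r - t₀|)) * δ with hU
    have hU0 : 0 ≤ U := by positivity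
    have hUc : U ^ c = Real.exp (η * θ) * Real.exp (η * |r - t₀|) * δ ^ c := by
      rw [hU, Real.mul_rpow (Real.exp_pos _).le hδ0, ← Real.exp_mul, ← Real.exp_add]
      congr 2
      rw [← hpc]; ring
    have hxr : ‖x r - x' r‖ ≤ U := (hgrow r).trans (by rw [hU]; gcongr)
    have hxζ : ‖x (ζ k) - x' (ζ k)‖ ≤ U := (hgrow _).trans (by rw [hU]; gcongr)
    have hΔr : ‖Δ r‖ ≤ N * (Real.exp (η * θ) * Real.exp (η * |r - t₀|)) := by
      rw [← Real.exp_add, ← mul_add]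
      exact (hΔN r).trans (by gcongr)
    have hΔζ : ‖Δ (ζ k)‖ ≤ N * (Real.exp (η * θ) * Real.exp (η * |r - t₀|)) := by
      rw [← Real.exp_add, ← mul_add]
      exact (hΔN _).trans (by gcongr)
    -- This intermediate point splits the increment of `h`: from `y` to `y₁` the displacement is `x
    -- - x'`, treated by the Hölder bound; from `y₁` to `y'` it is `Δ`, treated by the Lipschitz
    -- bound with its small constant.
    set y₁ := y r - (x r - x' r) with hy₁
    set y₂ := y (ζ k) - (x (ζ k) - x' (ζ k)) with hy₂
    have h1 : ‖h r (y r) (y (ζ k)) - h r y₁ y₂‖ ≤ (ℓ₁ + ℓ₂ + (μ + μ)) * U ^ c := by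
      refine le_mul_rpow_of_le hc0 hc1.le (by positivity) (by positivity) hU0
        ((norm_sub_le _ _).trans (add_le_add (hh.condA.norm_f_le _ _ _) (hh.condA.norm_f_le _ _ _)))
        ((hh.condA.lipschitz_f _ _ _ _ _).trans ?_)
      rw [hy₁, hy₂, sub_sub_cancel, sub_sub_cancel, add_mul]
      gcongr
    have h2 : ‖f r (x r) (x (ζ k)) - f r (x' r) (x' (ζ k))‖ ≤
        (ℓ₁' + ℓ₂' + (μ' + μ')) * U ^ c := by
      refine le_mul_rpow_of_le hc0 hc1.le (by positivity) (by positivity) hU0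
        ((norm_sub_le _ _).trans (add_le_add (hf.condA.norm_f_le _ _ _) (hf.condA.norm_f_le _ _ _)))
        ((hf.condA.lipschitz_f _ _ _ _ _).trans ?_)
      rw [add_mul]
      gcongr
    have h3 : ‖h r y₁ y₂ - h r (y' r) (y' (ζ k))‖ ≤
        (ℓ₁ + ℓ₂) * (N * (Real.exp (η * θ) * Real.exp (η * |r - t₀|))) := by
      refine (hh.condA.lipschitz_f _ _ _ _ _).trans ?_
      have e1 : y₁ - y' r = Δ r := by rw [hy₁, hΔ]; simp only []; abel
      have e2 : y₂ - y' (ζ k) = Δ (ζ k) := by rw [hy₂, hΔ]; simp only []; abel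
      rw [e1, e2, add_mul]
      gcongr
    have e : (h r (y r) (y (ζ k)) - f r (x r) (x (ζ k))) -
        (h r (y' r) (y' (ζ k)) - f r (x' r) (x' (ζ k))) =
        (h r (y r) (y (ζ k)) - h r y₁ y₂) - (f r (x r) (x (ζ k)) - f r (x' r) (x' (ζ k))) +
        (h r y₁ y₂ - h r (y' r) (y' (ζ k))) := by abel
    rw [e]
    calc _ ≤ _ := norm_add_le _ _
      _ ≤ _ := add_le_add ((norm_sub_le _ _).trans (add_le_add h1 h2)) h3
      _ = _ := by rw [hUc, hDdef]; ring
  have hN0 : 0 ≤ B + B' := (norm_nonneg _).trans (hBB 0)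
  have h1q : 0 < 1 - q := by linarith
  -- The bound `N` improves to `a + qN`, whose fixed point is `a/(1 - q)`. The start is the a priori
  -- bound `B + B'`, whose influence `q^n(B + B')` disappears in the limit; at `s = t₀` the weight
  -- is `1`.
  have hiter : ∀ n : ℕ, ∀ s, ‖Δ s‖ ≤ (a / (1 - q) + q ^ n * (B + B')) *
      Real.exp (η * |s - t₀|) := by
    intro n
    induction n with
    | zero =>
      intro s
      have h2 : 1 ≤ Real.exp (η * |s - t₀|) := Real.one_le_exp (by positivity)
      have h3 : B + B' ≤ a / (1 - q) + q ^ 0 * (B + B') := by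
        have : 0 ≤ a / (1 - q) := by positivity
        linarith
      exact (hBB s).trans (h3.trans (le_mul_of_one_le_right (hN0.trans h3) h2))
    | succ n ih =>
      intro s
      refine (hstep _ (by positivity) ih s).trans (le_of_eq ?_)
      congr 1
      field_simp
      ring
  have hlim : Tendsto (fun n : ℕ => a / (1 - q) + q ^ n * (B + B')) atTop
      (𝓝 (a / (1 - q) + 0 * (B + B'))) :=
    tendsto_const_nhds.add ((tendsto_pow_atTop_nhds_zero_of_lt_one hq0 hq1).mul_const _)
  have hfin := ge_of_tendsto' hlim fun n => by simpa using hiter n t₀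
  refine hfin.trans (le_of_eq ?_)
  rw [ha]
  ring

end Nonlinear

/-! ### Construction of the conjugating maps. -/

section Assembly

variable {E : Type*} [NormedAddCommGroup E]

lemma HolderAllTimes.unifContAllTimes {H : ℝ → E → E} (hH : HolderAllTimes H) :
    UnifContAllTimes H := by
  obtain ⟨C, c, hC, ⟨hc0, hc1⟩, hH⟩ := hH
  intro ε hε
  have hC0 : 0 < C := by linarith
  refine ⟨min 1 ((ε / C) ^ c⁻¹), by positivity, fun s u u' hu => ?_⟩
  refine (hH s u u' (hu.trans_le (min_le_left _ _))).trans_lt ?_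
  have h1 := Real.rpow_lt_rpow (norm_nonneg _) (hu.trans_le (min_le_right _ _)) hc0
  rw [← Real.rpow_mul (by positivity), inv_mul_cancel₀ hc0.ne', Real.rpow_one,
    lt_div_iff₀ hC0] at h1
  linarith

lemma UnifContAllTimes.continuous {H : ℝ → E → E} (hH : UnifContAllTimes H) (s : ℝ) :
    Continuous (H s) := by
  refine Metric.continuous_iff.2 fun u ε hε => ?_
  obtain ⟨δ, hδ, h⟩ := hH ε hε
  refine ⟨δ, hδ, fun v hv => ?_⟩
  rw [dist_eq_norm] at hv ⊢
  exact h s v u hv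

variable [NormedSpace ℝ E] [FiniteDimensional ℝ E] {t ζ : ℤ → ℝ} {γ : ℝ → ℝ}
  {A A₀ : ℝ → E →L[ℝ] E} {f h : ℝ → E → E → E}
  {M M₀ μ ℓ₁ ℓ₂ θ K α M' M₀' μ' ℓ₁' ℓ₂' θ' K' α' : ℝ}

lemma StrongHypWith.exists_through (hf : StrongHypWith t ζ γ A A₀ f M M₀ μ ℓ₁ ℓ₂ θ K α)
    (s : ℝ) (u : E) :
    ∃ x, PiecewiseSolution t ζ (fun _ => perturbedRHS A A₀ f) x ∧ x s = u := by
  have := FiniteDimensional.complete ℝ E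
  exact exists_piecewiseSolution hf.condB hf.lipschitz_perturbed hf.v_lt_one s u

/-- The map that sends the value of a solution of one perturbed system to the value of the
solution of the other perturbed system at bounded distance. -/
lemma StrongHypWith.exists_map
    (hf : StrongHypWith t ζ γ A A₀ f M' M₀' μ' ℓ₁' ℓ₂' θ' K' α')
    (hh : StrongHypWith t ζ γ A A₀ h M M₀ μ ℓ₁ ℓ₂ θ K α) :
    ∃ (H : ℝ → E → E) (C : ℝ), HolderAllTimes H ∧ (∀ s u, ‖H s u - u‖ ≤ C) ∧
      (∀ x, PiecewiseSolution t ζ (fun _ => perturbedRHS A A₀ f) x →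
        PiecewiseSolution t ζ (fun _ => perturbedRHS A A₀ h) fun s => H s (x s)) ∧
      ∀ x y, PiecewiseSolution t ζ (fun _ => perturbedRHS A A₀ f) x →
        PiecewiseSolution t ζ (fun _ => perturbedRHS A A₀ h) y →
        (∃ B, ∀ s, ‖y s - x s‖ ≤ B) → ∀ s, H s (x s) = y s := by
  obtain ⟨B, hnear⟩ := hh.exists_near hf.condA
  obtain ⟨C, c, hC, hc0, hc1, hhol⟩ := hf.norm_sub_le_rpow hh
  choose X hX hX0 using hf.exists_through
  choose Y hY hYX using fun s u => hnear (X s u) (hX s u)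
  -- `x` and the chosen solution through `(s, x s)` agree at `s`, so the Hölder bound there is `C *
  -- 0 ^ c = 0` and forces the companions to agree.
  have hmap : ∀ x y, PiecewiseSolution t ζ (fun _ => perturbedRHS A A₀ f) x →
      PiecewiseSolution t ζ (fun _ => perturbedRHS A A₀ h) y →
      (∃ B, ∀ s, ‖y s - x s‖ ≤ B) → ∀ s, Y s (x s) s = y s := by
    intro x y hx hy hxy s
    have h1 := hhol _ _ _ _ (hX s (x s)) hx (hY s (x s)) hy ⟨B, hYX s (x s)⟩ hxy s
    rw [hX0, sub_self, norm_zero, Real.zero_rpow hc0.ne', mul_zero, norm_le_zero_iff,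
      sub_sub_sub_cancel_right, sub_eq_zero] at h1
    exact h1
  refine ⟨fun s u => Y s u s, B, ?_, fun s u => ?_, fun x hx => ?_, hmap⟩
  -- Adding back the identity costs `1`, because `‖u - u'‖ ≤ ‖u - u'‖ ^ c` below distance `1`; the
  -- other unit makes the constant exceed `1`.
  · refine ⟨C + 2, c, by linarith, ⟨hc0, hc1⟩, fun s u u' huu => ?_⟩
    have h1 := hhol _ _ _ _ (hX s u) (hX s u') (hY s u) (hY s u') ⟨B, hYX s u⟩ ⟨B, hYX s u'⟩ s
    rw [hX0, hX0] at h1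
    have h2 : ‖u - u'‖ ≤ ‖u - u'‖ ^ c := by
      simpa using Real.rpow_le_rpow_of_exponent_ge' (norm_nonneg _) huu.le hc0.le hc1.le
    have h3 : 0 ≤ ‖u - u'‖ ^ c := Real.rpow_nonneg (norm_nonneg _) _
    have h4 : Y s u s - Y s u' s = (Y s u s - u - (Y s u' s - u')) + (u - u') := by abel
    rw [h4]
    refine (norm_add_le _ _).trans ?_
    linarith
  · have := hYX s u s
    rwa [hX0] at this
  · obtain ⟨y, hy, hyx⟩ := hnear x hx
    simpa only [hmap x y hx hy ⟨B, hyx⟩] using hy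

theorem StrongHypWith.holderStronglyTopEquiv
    (hf : StrongHypWith t ζ γ A A₀ f M' M₀' μ' ℓ₁' ℓ₂' θ' K' α')
    (hh : StrongHypWith t ζ γ A A₀ h M M₀ μ ℓ₁ ℓ₂ θ K α) :
    HolderStronglyTopEquiv t γ (perturbedRHS A A₀ f) (perturbedRHS A A₀ h) := by
  obtain ⟨H, C, hH, hHb, hHs, hHm⟩ := hf.exists_map hh
  obtain ⟨L, D, hL, hLb, hLs, hLm⟩ := hh.exists_map hf
  have hHc := hH.unifContAllTimes
  have hLc := hL.unifContAllTimes
  -- `x` lies at bounded distance from its image under `H`, so by uniqueness it is the companion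
  -- that `L` assigns to that image.
  have hLH : ∀ s, Function.LeftInverse (L s) (H s) := fun s u => by
    obtain ⟨x, hx, rfl⟩ := hf.exists_through s u
    exact hLm _ x (hHs x hx) hx ⟨C, fun r => by rw [norm_sub_rev]; exact hHb r _⟩ s
  have hHL : ∀ s, Function.RightInverse (L s) (H s) := fun s u => by
    obtain ⟨y, hy, rfl⟩ := hh.exists_through s u
    exact hHm _ y (hLs y hy) hy ⟨D, fun r => by rw [norm_sub_rev]; exact hLb r _⟩ s
  have hfi : ∀ x, IsSolution t γ (perturbedRHS A A₀ f) x ↔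
      PiecewiseSolution t ζ (fun _ => perturbedRHS A A₀ f) x := fun x =>
    isSolution_iff_piecewise hf.condB hf.lipschitz_perturbed
  have hhi : ∀ x, IsSolution t γ (perturbedRHS A A₀ h) x ↔
      PiecewiseSolution t ζ (fun _ => perturbedRHS A A₀ h) x := fun x =>
    isSolution_iff_piecewise hh.condB hh.lipschitz_perturbed
  let e : ℝ → E ≃ₜ E := fun s =>
    { toFun := H s
      invFun := L s
      left_inv := hLH s
      right_inv := hHL s
      continuous_toFun := hHc.continuous s
      continuous_invFun := hLc.continuous s }
  exact ⟨H, L, ⟨⟨fun s => (e s).isHomeomorph, ⟨C, hHb⟩,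
      fun x hx => (hhi _).2 (hHs x ((hfi x).1 hx))⟩,
    ⟨fun s => (e s).symm.isHomeomorph, ⟨D, hLb⟩,
      fun x hx => (hfi _).2 (hLs x ((hhi x).1 hx))⟩, hLH, hHL⟩, hHc, hLc, hH, hL⟩

end Assembly

end DEPCAG

theorem corollary3p1 {E : Type*} [NormedAddCommGroup E] [NormedSpace ℝ E] [FiniteDimensional ℝ E]
    (t ζ : ℤ → ℝ) (γ : ℝ → ℝ) (A A₀ : ℝ → E →L[ℝ] E) (f h : ℝ → E → E → E) :
    (DEPCAG.StrongHyp t ζ γ A A₀ f → DEPCAG.StrongHyp t ζ γ A A₀ h →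
      DEPCAG.StronglyTopEquiv t γ (DEPCAG.perturbedRHS A A₀ f) (DEPCAG.perturbedRHS A A₀ h)) ∧
    (DEPCAG.HolderHyp t ζ γ A A₀ f → DEPCAG.HolderHyp t ζ γ A A₀ h →
      DEPCAG.HolderStronglyTopEquiv t γ
        (DEPCAG.perturbedRHS A A₀ f) (DEPCAG.perturbedRHS A A₀ h)) := by
  constructor
  · rintro ⟨M', M₀', μ', ℓ₁', ℓ₂', θ', K', α', hf⟩ ⟨M, M₀, μ, ℓ₁, ℓ₂, θ, K, α, hh⟩
    obtain ⟨H, L, hHL, hH, hL, -, -⟩ := hf.holderStronglyTopEquiv hh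
    exact ⟨H, L, hHL, hH, hL⟩
  · rintro ⟨M', M₀', μ', ℓ₁', ℓ₂', θ', K', α', hf, -⟩ ⟨M, M₀, μ, ℓ₁, ℓ₂, θ, K, α, hh, -⟩
    exact hf.holderStronglyTopEquiv hh
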